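/- Let $k$ be an arbitrary field (of any characteristic), let $K/k$ be a separable quadratic field extension with norm $N_K$ and trace $T_K$, and let $\delta\in k^\times$ be a representative of the discriminant of $K/k$, i.e. $\delta=\det\big(T_K(b_ib_j)\big)$ for some $k$-basis $(b_1,b_2)$ of $K$ (so that in characteristic $2$ one may take $\delta=1$). For an octonion $k$-algebra $C$ with norm $N_C$, bilinearized norm $N_C(x,y)=N_C(x+y)-N_C(x)-N_C(y)$ and conjugation $\bar{\ }$, and for $\gamma_1,\gamma_2,\gamma_3\in k^\times$, let $\mathscr H_3(C,\langle\gamma_1,\gamma_2,\gamma_3\rangle)$ be the space of $3\times 3$ matrices $x=\sum\alpha_ie_{ii}+\sum x_i[jl]$ with $\alpha_i\in k$, $x_i\in C$ and $x_i[jl]=\gamma_lx_ie_{jl}+\gamma_j\overline{x_i}e_{lj}$, where $(ijl)$ runs over the cyclic permutations of $(123)$. It is a (quadratic) Jordan algebra with unit $1=\sum e_{ii}$ and $U$-operator $U_xy=T(x,y)x-x^\sharp\times y$, where $$x^\sharp=\sum\big(\alpha_j\alpha_l-\gamma_j\gamma_lN_C(x_i)\big)e_{ii}+\sum\big(\gamma_i\overline{x_jx_l}-\alpha_ix_i\big)[jl],$$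 $$T(x,y)=\sum\alpha_i\beta_i+\sum\gamma_j\gamma_lN_C(x_i,y_i)\quad\text{for } y=\sum\beta_ie_{ii}+\sum y_i[jl],$$ and $x\times y=(x+y)^\sharp-x^\sharp-y^\sharp$. An Albert $k$-algebra is a $k$-form of the split algebra $\mathscr H_3(C^d,\langle1,1,1\rangle)$, $C^d$ being the octonion algebra of Zorn vector matrices; that is, a quadratic Jordan $k$-algebra which becomes isomorphic to the split one over the separable closure of $k$. A commutative associative algebra is regarded as a Jordan algebra through $U_xy=xyx$. Let $A$ be an Albert $k$-algebra. Then $k\times K$ is isomorphic to a (unital) Jordan subalgebra of $A$ if and only if $$A\cong\mathscr H_3\big(C,\langle r,1,\delta N_K(s)\rangle\big)$$ for some octonion $k$-algebra $C$ and some elements $r\in k^\times$ and $s\in K^\times$ such that $T_K(s)\neq0$. -/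

import Mathlib

universe u v w

open scoped Matrix

/-! ### Octonion algebras -/

/-- An octonion (Cayley) algebra over a field `k`: a unital, not necessarily associative
`k`-algebra of dimension 8 with a multiplicative quadratic form (the norm) whose polar bilinear
form is nondegenerate. -/
class OctonionAlgebra (k : Type*) (C : Type*) [Field k] [NonAssocRing C] [Module k C] extends
    IsScalarTower k C C, SMulCommClass k C C where
  norm : QuadraticForm k C
  norm_mul : ∀ x y : C, norm (x * y) = norm x * norm y
  nondegenerate : ∀ x : C, (∀ y : C, QuadraticMap.polar norm x y = 0) → x = 0
  finrank_eq : Module.finrank k C = 8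

namespace OctonionAlgebra

variable (k : Type*) {C : Type*} [Field k] [NonAssocRing C] [Module k C] [OctonionAlgebra k C]

/-- The trace of an octonion algebra, `T_C(x) = N_C(x, 1)`. -/
def trace (x : C) : k := QuadraticMap.polar (norm (k := k) (C := C)) x 1

/-- The conjugation `x ↦ T_C(x) 1 - x` of an octonion algebra. -/
def conj (x : C) : C := trace k x • (1 : C) - x

theorem conj_add (x y : C) : conj k (x + y) = conj k x + conj k y := by
  simp only [conj, trace, QuadraticMap.polar_add_left, add_smul]; abel

theorem conj_smul (a : k) (x : C) : conj k (a • x) = a • conj k x := by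
  simp only [conj, trace, QuadraticMap.polar_smul_left, smul_sub, smul_smul, smul_eq_mul]

end OctonionAlgebra

/-! ### The split octonion algebra -/

/-- Zorn vector matrices `(a, u; v, b)` over `k`. -/
@[ext] structure Zorn (k : Type*) where
  a : k
  b : k
  u : Fin 3 → k
  v : Fin 3 → k

namespace Zorn

/-- The coordinates of a Zorn vector matrix. -/
def equivProd (k : Type*) : Zorn k ≃ k × k × (Fin 3 → k) × (Fin 3 → k) where
  toFun x := (x.a, x.b, x.u, x.v)
  invFun p := ⟨p.1, p.2.1, p.2.2.1, p.2.2.2⟩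
  left_inv _ := rfl
  right_inv _ := rfl

variable {k : Type*} [Field k]

instance : AddCommGroup (Zorn k) := (equivProd k).addCommGroup

instance {R : Type*} [Semiring R] [Module R k] : Module R (Zorn k) := (equivProd k).module R

@[simp] theorem add_a (x y : Zorn k) : (x + y).a = x.a + y.a := rfl
@[simp] theorem add_b (x y : Zorn k) : (x + y).b = x.b + y.b := rfl
@[simp] theorem add_u (x y : Zorn k) : (x + y).u = x.u + y.u := rfl
@[simp] theorem add_v (x y : Zorn k) : (x + y).v = x.v + y.v := rfl
@[simp] theorem sub_a (x y : Zorn k) : (x - y).a = x.a - y.a := rfl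
@[simp] theorem sub_b (x y : Zorn k) : (x - y).b = x.b - y.b := rfl
@[simp] theorem sub_u (x y : Zorn k) : (x - y).u = x.u - y.u := rfl
@[simp] theorem sub_v (x y : Zorn k) : (x - y).v = x.v - y.v := rfl
@[simp] theorem neg_a (x : Zorn k) : (-x).a = -x.a := rfl
@[simp] theorem neg_b (x : Zorn k) : (-x).b = -x.b := rfl
@[simp] theorem neg_u (x : Zorn k) : (-x).u = -x.u := rfl
@[simp] theorem neg_v (x : Zorn k) : (-x).v = -x.v := rfl
@[simp] theorem zero_a : (0 : Zorn k).a = 0 := rfl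
@[simp] theorem zero_b : (0 : Zorn k).b = 0 := rfl
@[simp] theorem zero_u : (0 : Zorn k).u = 0 := rfl
@[simp] theorem zero_v : (0 : Zorn k).v = 0 := rfl

section

variable {R : Type*} [Semiring R] [Module R k] (c : R) (x : Zorn k)

@[simp] theorem smul_a : (c • x).a = c • x.a := rfl
@[simp] theorem smul_b : (c • x).b = c • x.b := rfl
@[simp] theorem smul_u : (c • x).u = c • x.u := rfl
@[simp] theorem smul_v : (c • x).v = c • x.v := rfl

end

instance {R S : Type*} [Semiring R] [Semiring S] [Module R k] [Module S k] [SMul R S]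
    [IsScalarTower R S k] : IsScalarTower R S (Zorn k) where
  smul_assoc r s x := by
    ext <;> simp

instance : One (Zorn k) := ⟨⟨1, 1, 0, 0⟩⟩

@[simp] theorem one_a : (1 : Zorn k).a = 1 := rfl
@[simp] theorem one_b : (1 : Zorn k).b = 1 := rfl
@[simp] theorem one_u : (1 : Zorn k).u = 0 := rfl
@[simp] theorem one_v : (1 : Zorn k).v = 0 := rfl

/-- `(a, u; v, b)(a', u'; v', b')
  = (a a' + u ⬝ v', a u' + b' u - v × v'; a' v + b v' + u × u', b b' + v ⬝ u')`. -/
instance : Mul (Zorn k) :=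
  ⟨fun x y =>
    ⟨x.a * y.a + x.u ⬝ᵥ y.v,
     x.b * y.b + x.v ⬝ᵥ y.u,
     x.a • y.u + y.b • x.u - crossProduct x.v y.v,
     y.a • x.v + x.b • y.v + crossProduct x.u y.u⟩⟩

@[simp] theorem mul_a (x y : Zorn k) : (x * y).a = x.a * y.a + x.u ⬝ᵥ y.v := rfl
@[simp] theorem mul_b (x y : Zorn k) : (x * y).b = x.b * y.b + x.v ⬝ᵥ y.u := rfl
@[simp] theorem mul_u (x y : Zorn k) :
    (x * y).u = x.a • y.u + y.b • x.u - crossProduct x.v y.v := rfl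
@[simp] theorem mul_v (x y : Zorn k) :
    (x * y).v = y.a • x.v + x.b • y.v + crossProduct x.u y.u := rfl

instance : NonAssocRing (Zorn k) where
  left_distrib x y z := by
    apply Zorn.ext <;> simp only [mul_a, mul_b, mul_u, mul_v, add_a, add_b, add_u, add_v,
      dotProduct_add, map_add] <;> first | ring1 | module
  right_distrib x y z := by
    apply Zorn.ext <;> simp only [mul_a, mul_b, mul_u, mul_v, add_a, add_b, add_u, add_v,
      add_dotProduct, map_add, LinearMap.add_apply] <;> first | ring1 | module
  zero_mul x := by apply Zorn.ext <;> simp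
  mul_zero x := by apply Zorn.ext <;> simp
  one_mul x := by apply Zorn.ext <;> simp
  mul_one x := by apply Zorn.ext <;> simp

instance : IsScalarTower k (Zorn k) (Zorn k) where
  smul_assoc c x y := by
    apply Zorn.ext <;> simp only [smul_eq_mul, mul_a, mul_b, mul_u, mul_v, smul_a, smul_b, smul_u,
      smul_v, smul_dotProduct, map_smul, LinearMap.smul_apply] <;> first | ring1 | module

instance : SMulCommClass k (Zorn k) (Zorn k) where
  smul_comm c x y := by
    apply Zorn.ext <;> simp only [smul_eq_mul, mul_a, mul_b, mul_u, mul_v, smul_a, smul_b, smul_u,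
      smul_v, dotProduct_smul, map_smul] <;> first | ring1 | module

/-- The norm `(a, u; v, b) ↦ a b - u ⬝ v`. -/
def normForm (k : Type*) [Field k] : QuadraticForm k (Zorn k) :=
  QuadraticMap.ofPolar (fun x => x.a * x.b - x.u ⬝ᵥ x.v)
    (fun c x => by
      simp only [smul_a, smul_b, smul_u, smul_v, smul_eq_mul, smul_dotProduct, dotProduct_smul]
      ring)
    (fun x y z => by
      simp only [QuadraticMap.polar, add_a, add_b, add_u, add_v, add_dotProduct, dotProduct_add]
      ring)
    (fun c x y => by
      simp only [QuadraticMap.polar, smul_a, smul_b, smul_u, smul_v, add_a, add_b, add_u, add_v,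
        smul_eq_mul, smul_dotProduct, dotProduct_smul, add_dotProduct, dotProduct_add]
      ring)

theorem normForm_apply (x : Zorn k) : normForm k x = x.a * x.b - x.u ⬝ᵥ x.v := rfl

theorem polar_normForm (x y : Zorn k) : QuadraticMap.polar (normForm k) x y =
    x.a * y.b + y.a * x.b - x.u ⬝ᵥ y.v - y.u ⬝ᵥ x.v := by
  simp only [QuadraticMap.polar, normForm_apply, add_a, add_b, add_u, add_v, add_dotProduct,
    dotProduct_add]
  ring

theorem finrank_eq : Module.finrank k (Zorn k) = 8 := by
  rw [((equivProd k).linearEquiv k).finrank_eq]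
  simp

instance : OctonionAlgebra k (Zorn k) where
  norm := normForm k
  norm_mul x y := by
    simp only [normForm_apply, mul_a, mul_b, mul_u, mul_v, cross_apply, dotProduct,
      Fin.sum_univ_three, Pi.add_apply, Pi.sub_apply, Pi.smul_apply, smul_eq_mul, Matrix.cons_val]
    ring
  nondegenerate x h := by
    simp only [polar_normForm] at h
    have h1 := h ⟨0, 1, 0, 0⟩
    have h2 := h ⟨1, 0, 0, 0⟩
    have h3 := fun i => h ⟨0, 0, 0, Pi.single i 1⟩
    have h4 := fun i => h ⟨0, 0, Pi.single i 1, 0⟩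
    apply Zorn.ext
    · simpa using h1
    · simpa using h2
    · funext i; simpa using h3 i
    · funext i; simpa using h4 i
  finrank_eq := finrank_eq

end Zorn

/-! ### Quadratic Jordan structures -/

/-- The data of a unital quadratic Jordan algebra over `k` on the vector space `A`: a unit and a
`U`-operator `x ↦ U_x`, a quadratic map from `A` to the linear endomorphisms of `A`. (This records
the operations only. It is used for algebras where the Jordan identities are automatic: commutative
associative algebras, the algebras `H_3(C, Γ)`, and forms of the split Albert algebra.) -/
structure JordanStr (k : Type*) (A : Type*) [Field k] [AddCommGroup A] [Module k A] where
  one : A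
  U : QuadraticMap k A (Module.End k A)

/-- The `k`-linear map `f` is a homomorphism of unital quadratic Jordan algebras: it preserves the
unit and the `U`-operator. (The target may be an algebra over an extension of `k`.) -/
def JordanStr.IsHom {k L A B : Type*} [Field k] [Field L] [AddCommGroup A] [Module k A]
    [AddCommGroup B] [Module k B] [Module L B] (S : JordanStr k A) (S' : JordanStr L B)
    (f : A →ₗ[k] B) : Prop :=
  f S.one = S'.one ∧ ∀ x y : A, f (S.U x y) = S'.U (f x) (f y)

/-- The Jordan algebra of a commutative associative algebra: `U_x y = x y x`. -/
def JordanStr.ofComm (k R : Type*) [Field k] [CommRing R] [Algebra k R] : JordanStr k R where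
  one := 1
  U := LinearMap.BilinMap.toQuadraticMap ((LinearMap.mul k R).compr₂ (LinearMap.mul k R))

theorem JordanStr.ofComm_U {k R : Type*} [Field k] [CommRing R] [Algebra k R] (x y : R) :
    (JordanStr.ofComm k R).U x y = x * y * x := by
  change x * x * y = _
  ring

/-! ### The reduced algebras `H_3(C, Γ)` -/

/-- The vector space of 3-by-3 matrices `∑ α_i e_ii + ∑ x_i[jl]`, where
`x_i[jl] = γ_l x_i e_jl + γ_j (conj x_i) e_lj`, stored as `(α, x)`. The index `i` is taken in
`Fin 3`, where `j = i + 1` and `l = i + 2`, so that `(i j l)` is a cyclic permutation. -/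
abbrev Herm3 (k C : Type*) : Type _ := (Fin 3 → k) × (Fin 3 → C)

namespace Herm3

variable {k C : Type*} [Field k] [NonAssocRing C] [Module k C] [OctonionAlgebra k C]

open OctonionAlgebra

/-- The adjoint `x^♯ = ∑ (α_j α_l - γ_j γ_l N_C(x_i)) e_ii
  + ∑ (γ_i (conj (x_j x_l)) - α_i x_i)[jl]`. -/
def adj (γ : Fin 3 → k) : QuadraticMap k (Herm3 k C) (Herm3 k C) :=
  QuadraticMap.ofPolar
    (fun x =>
      (fun i => x.1 (i + 1) * x.1 (i + 2) - γ (i + 1) * γ (i + 2) * norm (k := k) (x.2 i),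
       fun i => γ i • conj k (x.2 (i + 1) * x.2 (i + 2)) - x.1 i • x.2 i))
    (fun c x => by
      refine Prod.ext (funext fun i => ?_) (funext fun i => ?_)
      · simp only [Prod.smul_fst, Prod.smul_snd, Pi.smul_apply, smul_eq_mul, QuadraticMap.map_smul]
        ring
      · simp only [Prod.smul_fst, Prod.smul_snd, Pi.smul_apply, smul_eq_mul, smul_mul_assoc,
          mul_smul_comm, conj_smul]
        module)
    (fun x y z => by
      refine Prod.ext (funext fun i => ?_) (funext fun i => ?_)
      · have h := QuadraticMap.polar_add_left (norm (k := k) (C := C)) (x.2 i) (y.2 i) (z.2 i)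
        simp only [QuadraticMap.polar] at h
        simp only [QuadraticMap.polar, Prod.fst_add, Prod.snd_add, Prod.fst_sub, Pi.add_apply,
          Pi.sub_apply]
        linear_combination (-(γ (i + 1) * γ (i + 2))) * h
      · simp only [QuadraticMap.polar, Prod.fst_add, Prod.snd_add, Prod.snd_sub, Pi.add_apply,
          Pi.sub_apply, add_mul, mul_add, conj_add]
        module)
    (fun c x y => by
      refine Prod.ext (funext fun i => ?_) (funext fun i => ?_)
      · have h := QuadraticMap.polar_smul_left (norm (k := k) (C := C)) c (x.2 i) (y.2 i)
        simp only [QuadraticMap.polar, smul_eq_mul] at h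
        simp only [QuadraticMap.polar, Prod.fst_add, Prod.snd_add, Prod.fst_sub, Pi.add_apply,
          Pi.sub_apply, Prod.smul_fst, Prod.smul_snd, Pi.smul_apply, smul_eq_mul]
        linear_combination (-(γ (i + 1) * γ (i + 2))) * h
      · simp only [QuadraticMap.polar, Prod.fst_add, Prod.snd_add, Prod.snd_sub, Pi.add_apply,
          Pi.sub_apply, Prod.smul_fst, Prod.smul_snd, Pi.smul_apply, add_mul, mul_add, conj_add,
          smul_mul_assoc, mul_smul_comm, conj_smul, smul_eq_mul]
        module)

theorem adj_apply (γ : Fin 3 → k) (x : Herm3 k C) : adj γ x =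
    (fun i => x.1 (i + 1) * x.1 (i + 2) - γ (i + 1) * γ (i + 2) * norm (k := k) (x.2 i),
     fun i => γ i • conj k (x.2 (i + 1) * x.2 (i + 2)) - x.1 i • x.2 i) := rfl

/-- The trace form `T(x, y) = ∑ α_i β_i + ∑ γ_j γ_l N_C(x_i, y_i)`. -/
def traceForm (γ : Fin 3 → k) : LinearMap.BilinForm k (Herm3 k C) :=
  LinearMap.mk₂ k
    (fun x y => ∑ i, (x.1 i * y.1 i +
      γ (i + 1) * γ (i + 2) * QuadraticMap.polar (norm (k := k) (C := C)) (x.2 i) (y.2 i)))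
    (fun x y z => by
      simp only [Prod.fst_add, Prod.snd_add, Pi.add_apply, QuadraticMap.polar_add_left,
        ← Finset.sum_add_distrib]
      exact Finset.sum_congr rfl fun i _ => by ring)
    (fun c x y => by
      simp only [Prod.smul_fst, Prod.smul_snd, Pi.smul_apply, QuadraticMap.polar_smul_left,
        smul_eq_mul, Finset.mul_sum]
      exact Finset.sum_congr rfl fun i _ => by ring)
    (fun x y z => by
      simp only [Prod.fst_add, Prod.snd_add, Pi.add_apply, QuadraticMap.polar_add_right,
        ← Finset.sum_add_distrib]
      exact Finset.sum_congr rfl fun i _ => by ring)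
    (fun c x y => by
      simp only [Prod.smul_fst, Prod.smul_snd, Pi.smul_apply, QuadraticMap.polar_smul_right,
        smul_eq_mul, Finset.mul_sum]
      exact Finset.sum_congr rfl fun i _ => by ring)

theorem traceForm_apply (γ : Fin 3 → k) (x y : Herm3 k C) : traceForm γ x y =
    ∑ i, (x.1 i * y.1 i +
      γ (i + 1) * γ (i + 2) * QuadraticMap.polar (norm (k := k) (C := C)) (x.2 i) (y.2 i)) := rfl

variable (k C) in
/-- The Jordan algebra `H_3(C, Γ)` for `Γ = ⟨γ_0, γ_1, γ_2⟩`: its unit is `∑ e_ii`, and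
`U_x y = T(x, y) x - x^♯ × y`, where `×` is the polarization of `♯` (see `jordan_U`). -/
def jordan (γ : Fin 3 → k) : JordanStr k (Herm3 k C) where
  one := (fun _ => 1, fun _ => 0)
  U := LinearMap.BilinMap.toQuadraticMap
      ((LinearMap.smulRightₗ (R := k) (M := Herm3 k C) (M₂ := Herm3 k C)).comp (traceForm γ))
    - (adj γ).polarBilin.compQuadraticMap (adj γ)

theorem jordan_U (γ : Fin 3 → k) (x y : Herm3 k C) :
    (jordan k C γ).U x y = traceForm γ x y • x - QuadraticMap.polar (adj γ) (adj γ x) y := rfl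

end Herm3

/-! ### Albert algebras -/

/-- An Albert algebra over `k` is a `k`-form of the split Albert algebra: it becomes isomorphic to
`H_3(C^d, ⟨1, 1, 1⟩)`, with `C^d` the split octonion algebra of Zorn vector matrices, over the
separable closure `F` of `k`. An isomorphism after extending scalars to `F` is recorded through its
restriction to `A`, a homomorphism `j` of Jordan algebras which exhibits the target as `F ⊗ A`. -/
def IsAlbert {k A : Type*} [Field k] [AddCommGroup A] [Module k A] (S : JordanStr k A) : Prop :=
  ∃ j : A →ₗ[k] Herm3 (SeparableClosure k) (Zorn (SeparableClosure k)),
    IsBaseChange (SeparableClosure k) j ∧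
    S.IsHom (Herm3.jordan (SeparableClosure k) (Zorn (SeparableClosure k)) fun _ => 1) j

/-! Over the separable closure F the algebra A carries cubic data: an adjoint ♯ and a trace form T
with U_x y = T(x, y) x - x^♯ × y. Let θ generate K, with θ² = tθ - n.

Suppose k × K embeds in A, and let e be the image of (1, 0). A nontrivial idempotent or its
complement has rank one (`isPrimitive_or_of_idempotent`). The complement of e cannot, because
U_{1-e} would then have a line as image, whereas it fixes the image of K. So e has rank one. Its
Peirce decomposition makes the linear and quadratic traces visible to U, hence k-valued on A, and
the whole cubic structure descends to k (`exists_descent`). The identities are linearized over the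
infinite field F before they descend, since k may be too small to compare coefficients.

Over k, e extends to a frame e_0 = e, e_1, e_2. The image w of θ lies in A_0(e), a block of size 2
with trace t and determinant n. If α is its e_1-entry, its off-diagonal component u₀ satisfies q(u₀)
= α(t - α) - n = -N_K(α - θ). This is nonzero and equals δ N_K(s) for some s of nonzero trace
(`exists_norm_eq`). Nonvanishing of A_1(e) gives an invertible u₂ in another off-diagonal space.
Jacobson coordinatization along u₀ and u₂ then produces an octonion algebra C and A ≅ H_3(C, ⟨q(u₂),
1, q(u₀)⟩).

Conversely, T_K(s) ≠ 0 allows one to write down a block of size 2 in H_3(C, ⟨r, 1, δ N_K(s)⟩) with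
scalar off-diagonal entries, trace t and determinant n. Sending θ to it embeds k × K
(`exists_hom_of_herm3`). -/

namespace Zorn

/-! ### Octonion identities for Zorn vector matrices. -/

theorem ext_coord {k : Type*} {x y : Zorn k} (ha : x.a = y.a) (hb : x.b = y.b) (hu0 : x.u 0 = y.u 0)
    (hu1 : x.u 1 = y.u 1) (hu2 : x.u 2 = y.u 2) (hv0 : x.v 0 = y.v 0) (hv1 : x.v 1 = y.v 1)
    (hv2 : x.v 2 = y.v 2) : x = y := by
  apply Zorn.ext ha hb
  · funext i; fin_cases i <;> assumption
  · funext i; fin_cases i <;> assumption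

variable {k : Type*} [Field k]

open OctonionAlgebra

theorem norm_apply (x : Zorn k) : norm (k := k) x = x.a * x.b - x.u ⬝ᵥ x.v := rfl

theorem polar_norm (x y : Zorn k) : QuadraticMap.polar (norm (k := k) (C := Zorn k)) x y =
    x.a * y.b + y.a * x.b - x.u ⬝ᵥ y.v - y.u ⬝ᵥ x.v := polar_normForm x y

theorem conj_eq (x : Zorn k) : conj k x = ⟨x.b, x.a, -x.u, -x.v⟩ := by
  have h : trace k x = x.a + x.b := by
    rw [trace, polar_norm]; simp
  apply Zorn.ext <;> simp [conj, h]

theorem norm_conj (x : Zorn k) : norm (k := k) (conj k x) = norm (k := k) x := by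
  simp [norm_apply, conj_eq, mul_comm]

/-- Both sides are the trace of the triple product, which is associative and cyclic. -/
theorem polar_conj_mul_cyclic (x y z : Zorn k) :
    QuadraticMap.polar (norm (k := k) (C := Zorn k)) (conj k (x * y)) z =
      QuadraticMap.polar (norm (k := k) (C := Zorn k)) (conj k (y * z)) x := by
  simp only [polar_norm, conj_eq, mul_a, mul_b, mul_u, mul_v, cross_apply, dotProduct,
    Fin.sum_univ_three, Pi.add_apply, Pi.sub_apply, Pi.neg_apply, Pi.smul_apply, smul_eq_mul,
    Matrix.cons_val]
  ring

theorem conj_conj_mul_mul (x y : Zorn k) :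
    conj k (conj k (x * y) * x) = norm (k := k) x • y := by
  apply ext_coord <;>
  simp only [norm_apply, conj_eq, mul_a, mul_b, mul_u, mul_v, cross_apply, dotProduct, smul_a,
    smul_b, smul_u, smul_v, Fin.sum_univ_three, Pi.add_apply, Pi.sub_apply, Pi.neg_apply,
    Pi.smul_apply, smul_eq_mul, Matrix.cons_val] <;> ring

theorem conj_mul_conj_mul (x y : Zorn k) :
    conj k (y * conj k (x * y)) = norm (k := k) y • x := by
  apply ext_coord <;>
  simp only [norm_apply, conj_eq, mul_a, mul_b, mul_u, mul_v, cross_apply, dotProduct, smul_a,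
    smul_b, smul_u, smul_v, Fin.sum_univ_three, Pi.add_apply, Pi.sub_apply, Pi.neg_apply,
    Pi.smul_apply, smul_eq_mul, Matrix.cons_val] <;> ring

-- This is the middle Moufang identity (xy)(zx) = x(yz)x, with the right side expanded through the
-- norm.
set_option maxHeartbeats 1000000 in
theorem conj_conj_mul_conj (x y z : Zorn k) :
    conj k (conj k (z * x) * conj k (x * y)) =
      QuadraticMap.polar (norm (k := k) (C := Zorn k)) (conj k (y * z)) x • x
        - norm (k := k) x • conj k (y * z) := by
  apply ext_coord <;>
  simp only [norm_apply, polar_norm, conj_eq, mul_a, mul_b, mul_u, mul_v, cross_apply, dotProduct,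
    smul_a, smul_b, smul_u, smul_v, sub_a, sub_b, sub_u, sub_v, Fin.sum_univ_three, Pi.add_apply,
    Pi.sub_apply, Pi.neg_apply, Pi.smul_apply, smul_eq_mul, Matrix.cons_val] <;> ring

end Zorn

/-! ### Cubic Jordan structures and comparison of coefficients. -/

/-- A nondegenerate cubic Jordan structure: a unit `1`, an adjoint `♯` and a symmetric bilinear
trace form `T`, subject to the linearized adjoint identities. -/
structure CubicJordan (k A : Type*) [Field k] [AddCommGroup A] [Module k A] where
  one : A
  adj : QuadraticMap k A A
  T : LinearMap.BilinForm k A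
  T_comm : ∀ x y, T x y = T y x
  T_nondeg : ∀ x, (∀ y, T x y = 0) → x = 0
  adj_one : adj one = one
  one_cross' : ∀ x, adj.polarBilin one x = T one x • one - x
  T_cross' : ∀ x y z, T (adj.polarBilin x y) z = T x (adj.polarBilin y z)
  adj_cross_adj' : ∀ x y, adj.polarBilin (adj x) (adj y) + adj (adj.polarBilin x y) =
    T (adj x) y • y + T x (adj y) • x
  cross_cross' : ∀ x y z, adj.polarBilin (adj x) (adj.polarBilin z y) +
    adj.polarBilin (adj.polarBilin x z) (adj.polarBilin x y) =
    T (adj x) z • y + T (adj x) y • z + T (adj.polarBilin x z) y • x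

/-- Coefficients of a vector polynomial vanishing on an infinite field vanish. -/
theorem forall_coeff_eq_zero_of_infinite {k M ι : Type*} [Field k] [Infinite k] [AddCommGroup M]
    [Module k M] [Fintype ι] (e : ι → ℕ) (he : Function.Injective e) (m : ι → M)
    (h : ∀ t : k, ∑ i, t ^ e i • m i = 0) (i : ι) : m i = 0 := by
  classical
  rw [← Module.forall_dual_apply_eq_zero_iff k]
  intro f
  set p : Polynomial k := ∑ i, Polynomial.monomial (e i) (f (m i)) with hp
  have h0 : p = 0 := by
    apply Polynomial.funext
    intro t
    have := congrArg f (h t)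
    simp only [map_sum, map_smul, smul_eq_mul, map_zero] at this
    simp only [hp, Polynomial.eval_finsetSum, Polynomial.eval_monomial, Polynomial.eval_zero]
    rw [← this]
    exact Finset.sum_congr rfl fun i _ => mul_comm _ _
  have h1 := congrArg (fun q => Polynomial.coeff q (e i)) h0
  simpa [hp, Polynomial.coeff_monomial, he.eq_iff] using h1

/-- A finite field is perfect, so if separably closed it would be algebraically closed, hence
infinite. -/
theorem IsSepClosed.infinite (F : Type*) [Field F] [IsSepClosed F] : Infinite F := by
  by_contra h
  rw [not_infinite_iff_finite] at h
  have : IsAlgClosed F := inferInstance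
  exact (not_finite_iff_infinite.mpr (IsAlgClosed.instInfinite)) h

/-! ### The split Albert algebra as a cubic Jordan structure. -/

namespace Herm3

section

variable {k C : Type*} [Field k] [NonAssocRing C] [Module k C] [OctonionAlgebra k C]

open OctonionAlgebra

theorem polar_adj (γ : Fin 3 → k) (x y : Herm3 k C) : QuadraticMap.polar (adj γ) x y =
    (fun i => x.1 (i + 1) * y.1 (i + 2) + y.1 (i + 1) * x.1 (i + 2) -
      γ (i + 1) * γ (i + 2) * QuadraticMap.polar (norm (k := k) (C := C)) (x.2 i) (y.2 i),
     fun i => γ i • conj k (x.2 (i + 1) * y.2 (i + 2) + y.2 (i + 1) * x.2 (i + 2)) -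
      x.1 i • y.2 i - y.1 i • x.2 i) := by
  refine Prod.ext (funext fun i => ?_) (funext fun i => ?_)
  · simp only [QuadraticMap.polar, adj_apply, Prod.fst_add, Prod.snd_add, Prod.fst_sub,
      Pi.add_apply, Pi.sub_apply]
    ring
  · simp only [QuadraticMap.polar, adj_apply, Prod.fst_add, Prod.snd_add, Prod.snd_sub,
      Pi.add_apply, Pi.sub_apply, add_mul, mul_add, conj_add]
    module

end

variable {k : Type*} [Field k]

open OctonionAlgebra

local notation "H" => Herm3 k (Zorn k)
local notation "γ₁" => (fun _ : Fin 3 => (1 : k))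

/-- The cubic norm of the split Albert algebra. -/
def cubicNorm (x : H) : k :=
  x.1 0 * x.1 1 * x.1 2 - x.1 0 * norm (k := k) (x.2 0) - x.1 1 * norm (k := k) (x.2 1)
    - x.1 2 * norm (k := k) (x.2 2)
    + QuadraticMap.polar (norm (k := k) (C := Zorn k)) (conj k (x.2 1 * x.2 2)) (x.2 0)

theorem cubicNorm_eq (x : H) (i : Fin 3) : cubicNorm x =
    x.1 i * x.1 (i + 1) * x.1 (i + 2) - x.1 i * norm (k := k) (x.2 i)
    - x.1 (i + 1) * norm (k := k) (x.2 (i + 1)) - x.1 (i + 2) * norm (k := k) (x.2 (i + 2))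
    + QuadraticMap.polar (norm (k := k) (C := Zorn k)) (conj k (x.2 (i + 1) * x.2 (i + 2)))
      (x.2 i) := by
  have h1 := Zorn.polar_conj_mul_cyclic (x.2 0) (x.2 1) (x.2 2)
  have h2 := Zorn.polar_conj_mul_cyclic (x.2 2) (x.2 0) (x.2 1)
  fin_cases i
  · rfl
  · change _ = x.1 1 * x.1 2 * x.1 0 - x.1 1 * norm (k := k) (x.2 1)
      - x.1 2 * norm (k := k) (x.2 2) - x.1 0 * norm (k := k) (x.2 0)
      + QuadraticMap.polar (norm (k := k) (C := Zorn k)) (conj k (x.2 2 * x.2 0)) (x.2 1)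
    rw [cubicNorm]
    linear_combination -h1 - h2
  · change _ = x.1 2 * x.1 0 * x.1 1 - x.1 2 * norm (k := k) (x.2 2)
      - x.1 0 * norm (k := k) (x.2 0) - x.1 1 * norm (k := k) (x.2 1)
      + QuadraticMap.polar (norm (k := k) (C := Zorn k)) (conj k (x.2 0 * x.2 1)) (x.2 2)
    rw [cubicNorm]
    linear_combination -h1

theorem index_one_one (i : Fin 3) : i + 1 + 1 = i + 2 := by decide +revert
theorem index_one_two (i : Fin 3) : i + 1 + 2 = i := by decide +revert
theorem index_two_one (i : Fin 3) : i + 2 + 1 = i := by decide +revert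
theorem index_two_two (i : Fin 3) : i + 2 + 2 = i + 1 := by decide +revert

theorem norm_sub (x y : Zorn k) : norm (k := k) (x - y) = norm (k := k) x + norm (k := k) y -
    QuadraticMap.polar (norm (k := k) (C := Zorn k)) x y := by
  rw [sub_eq_add_neg, QuadraticMap.map_add (norm (k := k) (C := Zorn k)), QuadraticMap.map_neg,
    QuadraticMap.polar_neg_right]
  ring

theorem conj_sub (x y : Zorn k) : conj k (x - y) = conj k x - conj k y := by
  simp only [Zorn.conj_eq]; ext <;> simp <;> ring

theorem adj_adj (x : H) : adj γ₁ (adj γ₁ x) = cubicNorm x • x := by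
  refine Prod.ext (funext fun i => ?_) (funext fun i => ?_)
  · simp only [adj_apply, one_mul, one_smul, index_one_one, index_one_two, index_two_one,
      index_two_two, norm_sub, Zorn.norm_conj, OctonionAlgebra.norm_mul, QuadraticMap.map_smul,
      QuadraticMap.polar_smul_right, smul_eq_mul, Prod.smul_fst, Pi.smul_apply, cubicNorm_eq x i]
    ring
  · simp only [adj_apply, one_mul, one_smul, index_one_one, index_one_two, index_two_one,
      index_two_two, Prod.smul_snd, Pi.smul_apply, cubicNorm_eq x i, sub_mul, mul_sub,
      smul_mul_assoc, mul_smul_comm, conj_sub, conj_smul, Zorn.conj_conj_mul_conj,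
      Zorn.conj_conj_mul_mul, Zorn.conj_mul_conj_mul]
    module

theorem norm_add (x y : Zorn k) : norm (k := k) (x + y) = norm (k := k) x + norm (k := k) y +
    QuadraticMap.polar (norm (k := k) (C := Zorn k)) x y :=
  QuadraticMap.map_add _ x y

/-- The trilinear form `N(conj (x y), z)`, which is invariant under cyclic permutations. -/
def tri (x y z : Zorn k) : k := QuadraticMap.polar (norm (k := k) (C := Zorn k)) (conj k (x * y)) z

theorem polar_left_eq_tri (x y z : Zorn k) :
    QuadraticMap.polar (norm (k := k) (C := Zorn k)) (conj k (x * y)) z = tri x y z := rfl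

theorem polar_right_eq_tri (x y z : Zorn k) :
    QuadraticMap.polar (norm (k := k) (C := Zorn k)) z (conj k (x * y)) = tri x y z :=
  QuadraticMap.polar_comm _ _ _

theorem tri_cyclic (x y z : Zorn k) : tri x y z = tri y z x := Zorn.polar_conj_mul_cyclic x y z

theorem tri_add_left (x x' y z : Zorn k) : tri (x + x') y z = tri x y z + tri x' y z := by
  simp only [tri, add_mul, conj_add, QuadraticMap.polar_add_left]

theorem tri_smul_left (t : k) (x y z : Zorn k) : tri (t • x) y z = t * tri x y z := by
  simp only [tri, smul_mul_assoc, conj_smul, QuadraticMap.polar_smul_left, smul_eq_mul]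

theorem tri_add_middle (x y y' z : Zorn k) : tri x (y + y') z = tri x y z + tri x y' z := by
  rw [tri_cyclic, tri_add_left, ← tri_cyclic x y z, ← tri_cyclic x y' z]

theorem tri_smul_middle (t : k) (x y z : Zorn k) : tri x (t • y) z = t * tri x y z := by
  rw [tri_cyclic, tri_smul_left, ← tri_cyclic x y z]

theorem tri_add_right (x y z z' : Zorn k) : tri x y (z + z') = tri x y z + tri x y z' := by
  rw [tri, QuadraticMap.polar_add_right]; rfl

theorem tri_smul_right (t : k) (x y z : Zorn k) : tri x y (t • z) = t * tri x y z := by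
  rw [tri, QuadraticMap.polar_smul_right]; rfl

theorem traceForm_eq (x y : H) : traceForm γ₁ x y = x.1 0 * y.1 0 + x.1 1 * y.1 1 + x.1 2 * y.1 2
    + QuadraticMap.polar (norm (k := k) (C := Zorn k)) (x.2 0) (y.2 0)
    + QuadraticMap.polar (norm (k := k) (C := Zorn k)) (x.2 1) (y.2 1)
    + QuadraticMap.polar (norm (k := k) (C := Zorn k)) (x.2 2) (y.2 2) := by
  rw [traceForm_apply, Fin.sum_univ_three]
  ring

theorem adj_eq (x : H) : adj γ₁ x =
    (![x.1 1 * x.1 2 - norm (k := k) (x.2 0), x.1 2 * x.1 0 - norm (k := k) (x.2 1),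
       x.1 0 * x.1 1 - norm (k := k) (x.2 2)],
     ![conj k (x.2 1 * x.2 2) - x.1 0 • x.2 0, conj k (x.2 2 * x.2 0) - x.1 1 • x.2 1,
       conj k (x.2 0 * x.2 1) - x.1 2 • x.2 2]) := by
  rw [adj_apply]
  refine Prod.ext (funext fun i => ?_) (funext fun i => ?_) <;> fin_cases i <;> simp

theorem polar_adj_eq (x y : H) : QuadraticMap.polar (adj γ₁) x y =
    (![x.1 1 * y.1 2 + y.1 1 * x.1 2 - QuadraticMap.polar (norm (k := k)) (x.2 0) (y.2 0),
       x.1 2 * y.1 0 + y.1 2 * x.1 0 - QuadraticMap.polar (norm (k := k)) (x.2 1) (y.2 1),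
       x.1 0 * y.1 1 + y.1 0 * x.1 1 - QuadraticMap.polar (norm (k := k)) (x.2 2) (y.2 2)],
     ![conj k (x.2 1 * y.2 2 + y.2 1 * x.2 2) - x.1 0 • y.2 0 - y.1 0 • x.2 0,
       conj k (x.2 2 * y.2 0 + y.2 2 * x.2 0) - x.1 1 • y.2 1 - y.1 1 • x.2 1,
       conj k (x.2 0 * y.2 1 + y.2 0 * x.2 1) - x.1 2 • y.2 2 - y.1 2 • x.2 2]) := by
  rw [polar_adj]
  refine Prod.ext (funext fun i => ?_) (funext fun i => ?_) <;> fin_cases i <;> simp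

theorem cubicNorm_add_smul (x y : H) (t : k) : cubicNorm (x + t • y) = cubicNorm x +
    t * traceForm γ₁ (adj γ₁ x) y + t ^ 2 * traceForm γ₁ x (adj γ₁ y) + t ^ 3 * cubicNorm y := by
  -- Cyclic rotations bring each trilinear term to one normal form, so that `ring` sees equal terms
  -- as the same atom.
  have c1 : ∀ x y : H, tri (x.2 2) (x.2 0) (y.2 1) = tri (y.2 1) (x.2 2) (x.2 0) := fun x y =>
    (tri_cyclic _ _ _).symm
  have c2 : ∀ x y : H, tri (x.2 0) (x.2 1) (y.2 2) = tri (x.2 1) (y.2 2) (x.2 0) := fun x y =>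
    tri_cyclic _ _ _
  simp only [cubicNorm, traceForm_eq, adj_eq, Prod.fst_add, Prod.snd_add, Matrix.cons_val,
    Prod.smul_fst, Prod.smul_snd, Pi.add_apply, Pi.smul_apply, smul_eq_mul, norm_add,
    QuadraticMap.polar_sub_left, QuadraticMap.polar_sub_right, QuadraticMap.map_smul,
    polar_left_eq_tri, polar_right_eq_tri, tri_add_left, tri_add_right, tri_add_middle,
    tri_smul_left, tri_smul_right, tri_smul_middle, c1, c2,
    QuadraticMap.polar_smul_left, QuadraticMap.polar_smul_right]
  ring

theorem traceForm_comm (x y : H) : traceForm γ₁ x y = traceForm γ₁ y x := by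
  simp only [traceForm_apply]
  refine Finset.sum_congr rfl fun i _ => ?_
  rw [QuadraticMap.polar_comm, mul_comm (x.1 i)]

theorem traceForm_nondeg (x : H) (h : ∀ y, traceForm γ₁ x y = 0) : x = 0 := by
  refine Prod.ext (funext fun i => ?_) (funext fun i => ?_)
  · simpa [traceForm_apply, Pi.single_apply] using h (Pi.single i 1, 0)
  · refine nondegenerate (k := k) _ fun y => ?_
    have := h (0, Pi.single i y)
    simp only [traceForm_apply, Pi.zero_apply, mul_zero, zero_add, one_mul] at this
    rw [Finset.sum_eq_single i] at this
    · simpa using this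
    · intro j _ hj
      simp [hj]
    · simp

theorem traceForm_polar_adj (x y z : H) : traceForm γ₁ (QuadraticMap.polar (adj γ₁) x y) z =
    traceForm γ₁ x (QuadraticMap.polar (adj γ₁) y z) := by
  have c1 : ∀ x y z : H, tri (x.2 2) (y.2 0) (z.2 1) = tri (z.2 1) (x.2 2) (y.2 0) :=
    fun x y z => (tri_cyclic _ _ _).symm
  have c2 : ∀ x y z : H, tri (x.2 0) (y.2 1) (z.2 2) = tri (y.2 1) (z.2 2) (x.2 0) :=
    fun x y z => tri_cyclic _ _ _
  simp only [traceForm_eq, polar_adj_eq, Matrix.cons_val, conj_add, smul_eq_mul,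
    QuadraticMap.polar_add_left, QuadraticMap.polar_add_right,
    QuadraticMap.polar_sub_left, QuadraticMap.polar_sub_right,
    polar_left_eq_tri, polar_right_eq_tri, c1, c2,
    QuadraticMap.polar_smul_left, QuadraticMap.polar_smul_right]
  ring

theorem one_eq : (jordan k (Zorn k) γ₁).one = (fun _ => 1, fun _ => 0) := rfl

theorem polar_adj_one (x : H) : QuadraticMap.polar (adj γ₁) (jordan k (Zorn k) γ₁).one x =
    traceForm γ₁ (jordan k (Zorn k) γ₁).one x • (jordan k (Zorn k) γ₁).one - x := by
  rw [polar_adj_eq, traceForm_eq, one_eq]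
  refine Prod.ext (funext fun i => ?_) (funext fun i => ?_) <;> fin_cases i <;>
    simp [QuadraticMap.polar, Zorn.conj_eq, Zorn.ext_iff] <;> ring

theorem adj_one : adj γ₁ (jordan k (Zorn k) γ₁).one = (jordan k (Zorn k) γ₁).one := by
  refine Prod.ext (funext fun i => ?_) (funext fun i => ?_)
  · simp [jordan, adj_apply]
  · simp [jordan, adj_apply, Zorn.conj_eq, Zorn.ext_iff]

section

variable [Infinite k]

/-- The coefficients of `t` and `t ^ 2` in the adjoint identity at `x + t y`. -/
theorem adj_identities (x y : H) :
    QuadraticMap.polar (adj γ₁) (adj γ₁ x) (QuadraticMap.polar (adj γ₁) x y) =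
      cubicNorm x • y + traceForm γ₁ (adj γ₁ x) y • x ∧
    QuadraticMap.polar (adj γ₁) (adj γ₁ x) (adj γ₁ y) + adj γ₁ (QuadraticMap.polar (adj γ₁) x y) =
      traceForm γ₁ (adj γ₁ x) y • y + traceForm γ₁ x (adj γ₁ y) • x := by
  -- These are the differences of the coefficients of t^i in (x + ty)^♯♯ = N(x + ty)(x + ty). The
  -- two outer ones vanish by `adj_adj` for x and for y.
  have h : ∀ t : k, ∑ i : Fin 5, t ^ (i : ℕ) • (![0,
      QuadraticMap.polar (adj γ₁) (adj γ₁ x) (QuadraticMap.polar (adj γ₁) x y) -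
        (cubicNorm x • y + traceForm γ₁ (adj γ₁ x) y • x),
      QuadraticMap.polar (adj γ₁) (adj γ₁ x) (adj γ₁ y) +
        adj γ₁ (QuadraticMap.polar (adj γ₁) x y) -
        (traceForm γ₁ (adj γ₁ x) y • y + traceForm γ₁ x (adj γ₁ y) • x),
      QuadraticMap.polar (adj γ₁) (adj γ₁ y) (QuadraticMap.polar (adj γ₁) x y) -
        (traceForm γ₁ x (adj γ₁ y) • y + cubicNorm y • x), 0] : Fin 5 → H) i = 0 := by
    intro t
    have h0 := adj_adj (x + t • y)
    have hx := adj_adj x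
    have hy := adj_adj y
    rw [cubicNorm_add_smul] at h0
    simp only [QuadraticMap.map_add (adj γ₁), QuadraticMap.map_smul, QuadraticMap.polar_add_left,
      QuadraticMap.polar_smul_right, QuadraticMap.polar_smul_left, hx, hy, add_smul, smul_add] at h0
    simp only [Fin.sum_univ_five, Matrix.cons_val]
    rw [← sub_eq_zero] at h0
    refine Eq.trans ?_ h0
    simp only [Fin.val_zero, Fin.val_one, Fin.val_two, show ((3 : Fin 5) : ℕ) = 3 from rfl,
      show ((4 : Fin 5) : ℕ) = 4 from rfl]
    module
  have h' := forall_coeff_eq_zero_of_infinite (fun i : Fin 5 => (i : ℕ)) Fin.val_injective _ h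
  exact ⟨sub_eq_zero.mp (h' 1), sub_eq_zero.mp (h' 2)⟩

/-- Replace x by x + tz in the first of the `adj_identities` and take the coefficient of t; the
outer coefficients are that identity for x and for z. -/
theorem adj_identity_linearized (x y z : H) :
    QuadraticMap.polar (adj γ₁) (adj γ₁ x) (QuadraticMap.polar (adj γ₁) z y) +
      QuadraticMap.polar (adj γ₁) (QuadraticMap.polar (adj γ₁) x z)
        (QuadraticMap.polar (adj γ₁) x y) =
    traceForm γ₁ (adj γ₁ x) z • y + traceForm γ₁ (adj γ₁ x) y • z +
      traceForm γ₁ (QuadraticMap.polar (adj γ₁) x z) y • x := by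
  have h : ∀ t : k, ∑ i : Fin 4, t ^ (i : ℕ) • (![0,
      QuadraticMap.polar (adj γ₁) (adj γ₁ x) (QuadraticMap.polar (adj γ₁) z y) +
      QuadraticMap.polar (adj γ₁) (QuadraticMap.polar (adj γ₁) x z)
        (QuadraticMap.polar (adj γ₁) x y) -
      (traceForm γ₁ (adj γ₁ x) z • y + traceForm γ₁ (adj γ₁ x) y • z +
      traceForm γ₁ (QuadraticMap.polar (adj γ₁) x z) y • x),
      QuadraticMap.polar (adj γ₁) (adj γ₁ z) (QuadraticMap.polar (adj γ₁) x y) +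
      QuadraticMap.polar (adj γ₁) (QuadraticMap.polar (adj γ₁) x z)
        (QuadraticMap.polar (adj γ₁) z y) -
      (traceForm γ₁ x (adj γ₁ z) • y + traceForm γ₁ (adj γ₁ z) y • x +
      traceForm γ₁ (QuadraticMap.polar (adj γ₁) x z) y • z), 0] : Fin 4 → H) i = 0 := by
    intro t
    have h0 := (adj_identities (x + t • z) y).1
    have hx := (adj_identities x y).1
    have hz := (adj_identities z y).1
    rw [cubicNorm_add_smul] at h0
    simp only [QuadraticMap.map_add (adj γ₁), QuadraticMap.map_smul, QuadraticMap.polar_add_left,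
      QuadraticMap.polar_add_right, map_add, map_smul, LinearMap.add_apply, LinearMap.smul_apply,
      QuadraticMap.polar_smul_right, QuadraticMap.polar_smul_left, hx, hz, add_smul, smul_add,
      smul_eq_mul] at h0
    simp only [Fin.sum_univ_four, Matrix.cons_val]
    rw [← sub_eq_zero] at h0
    refine Eq.trans ?_ h0
    simp only [Fin.val_zero, Fin.val_one, Fin.val_two, show ((3 : Fin 4) : ℕ) = 3 from rfl]
    module
  have h' := forall_coeff_eq_zero_of_infinite (fun i : Fin 4 => (i : ℕ)) Fin.val_injective _ h
  exact sub_eq_zero.mp (h' 1)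

variable (k) in
/-- The cubic Jordan structure of the split Albert algebra. -/
def cubicJordan : CubicJordan k H where
  one := (jordan k (Zorn k) γ₁).one
  adj := adj γ₁
  T := traceForm γ₁
  T_comm := traceForm_comm
  T_nondeg := traceForm_nondeg
  adj_one := adj_one
  one_cross' x := by
    simpa only [QuadraticMap.polarBilin_apply_apply] using polar_adj_one x
  T_cross' x y z := by
    simpa only [QuadraticMap.polarBilin_apply_apply] using traceForm_polar_adj x y z
  adj_cross_adj' x y := by
    simpa only [QuadraticMap.polarBilin_apply_apply] using (adj_identities x y).2
  cross_cross' x y z := by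
    simpa only [QuadraticMap.polarBilin_apply_apply] using adj_identity_linearized x y z

end

end Herm3

/-! ### Peirce calculus of a single idempotent of rank one. -/

namespace CubicJordan

variable {k A : Type*} [Field k] [AddCommGroup A] [Module k A] (S : CubicJordan k A)

/-- The bilinear product `x × y`, the polarization of the adjoint. -/
def cross : A →ₗ[k] A →ₗ[k] A := S.adj.polarBilin

/-- The linear trace. -/
def tr : A →ₗ[k] k := S.T S.one

/-- The `U`-operator `U_x y = T(x, y) x - x^♯ × y`. -/
def U (x y : A) : A := S.T x y • x - S.cross (S.adj x) y

theorem adj_add (x y : A) : S.adj (x + y) = S.adj x + S.adj y + S.cross x y :=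
  QuadraticMap.map_add _ x y

theorem adj_smul (c : k) (x : A) : S.adj (c • x) = (c * c) • S.adj x := QuadraticMap.map_smul _ c x

theorem adj_neg (x : A) : S.adj (-x) = S.adj x := QuadraticMap.map_neg _ x

theorem adj_sub (x y : A) : S.adj (x - y) = S.adj x + S.adj y - S.cross x y := by
  rw [sub_eq_add_neg, adj_add, adj_neg, map_neg, ← sub_eq_add_neg]

theorem cross_comm (x y : A) : S.cross x y = S.cross y x := QuadraticMap.polar_comm _ x y

theorem cross_self (x : A) : S.cross x x = (2 : k) • S.adj x := by
  have h : S.cross x x = 2 • S.adj x := QuadraticMap.polar_self _ x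
  rw [h, two_smul, two_smul]

theorem one_cross (x : A) : S.cross S.one x = S.tr x • S.one - x := S.one_cross' x

theorem cross_one (x : A) : S.cross x S.one = S.tr x • S.one - x := by
  rw [cross_comm, one_cross]

theorem T_cross (x y z : A) : S.T (S.cross x y) z = S.T x (S.cross y z) := S.T_cross' x y z

theorem T_one (x : A) : S.T x S.one = S.tr x := S.T_comm _ _

theorem one_T (x : A) : S.T S.one x = S.tr x := rfl

theorem adj_cross_adj (x y : A) : S.cross (S.adj x) (S.adj y) + S.adj (S.cross x y) =
    S.T (S.adj x) y • y + S.T x (S.adj y) • x := S.adj_cross_adj' x y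

theorem cross_cross (x y z : A) : S.cross (S.adj x) (S.cross z y) +
    S.cross (S.cross x z) (S.cross x y) =
    S.T (S.adj x) z • y + S.T (S.adj x) y • z + S.T (S.cross x z) y • x := S.cross_cross' x y z

/-- Polarizing in the remaining quadratic variable involves only subtraction, so it is valid over
every field. -/
theorem cross_cross_linearized (x w y z : A) : S.cross (S.cross x w) (S.cross z y) +
    S.cross (S.cross x z) (S.cross w y) + S.cross (S.cross w z) (S.cross x y) =
    S.T (S.cross x w) z • y + S.T (S.cross x w) y • z + S.T (S.cross x z) y • w +
      S.T (S.cross w z) y • x := by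
  have h := S.cross_cross (x + w) y z
  have h1 := S.cross_cross x y z
  have h2 := S.cross_cross w y z
  simp only [adj_add, map_add, LinearMap.add_apply] at h
  linear_combination (norm := module) h - h1 - h2

theorem tr_cross (x y : A) : S.tr (S.cross x y) = S.tr x * S.tr y - S.T x y := by
  rw [← T_one, T_cross, cross_one, map_sub, map_smul, T_one, smul_eq_mul, mul_comm]

/-- Idempotents of rank one. -/
structure IsPrimitive (e : A) : Prop where
  adj_eq : S.adj e = 0
  tr_eq : S.tr e = 1

/-- The Peirce space `A_1(e)`. -/
structure PeirceOne (e x : A) : Prop where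
  cross_eq : S.cross e x = 0
  T_eq : S.T e x = 0

/-- The Peirce space `A_0(e)`. -/
structure PeirceZero (e x : A) : Prop where
  cross_eq : S.cross e x = S.tr x • (S.one - e) - x
  T_eq : S.T e x = 0

/-- The projection onto `A_1(e)`. -/
def peirceOne (e y : A) : A :=
  S.cross e y + S.tr y • e + y - (S.tr y - S.T e y) • S.one - (2 * S.T e y) • e

/-- The projection onto `A_0(e)`. -/
def peirceZero (e y : A) : A := (S.tr y - S.T e y) • (S.one - e) - S.cross e y

theorem eq_peirce (e y : A) : y = S.T e y • e + S.peirceOne e y + S.peirceZero e y := by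
  rw [peirceOne, peirceZero]; module

variable {S}

namespace IsPrimitive

variable {e : A} (he : S.IsPrimitive e)
include he

theorem cross_self : S.cross e e = 0 := by rw [CubicJordan.cross_self, he.adj_eq, smul_zero]

theorem T_self : S.T e e = 1 := by
  have h := S.tr_cross e e
  rw [he.cross_self, map_zero, he.tr_eq] at h
  linear_combination h

/-- Evaluate T(e, 1 × 1) in two ways, using 1 × 1 = 2 · 1. -/
theorem tr_one_sub : S.tr (S.one - e) = 2 := by
  have h3 : S.cross S.one S.one = (2 : k) • S.one := by rw [S.cross_self, S.adj_one]
  have h4 := S.T_cross e S.one S.one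
  rw [h3, cross_one, he.tr_eq, one_smul, T_one, map_smul, T_one, he.tr_eq, smul_eq_mul,
    mul_one] at h4
  exact h4

theorem adj_one_sub : S.adj (S.one - e) = e := by
  rw [adj_sub, he.adj_eq, S.adj_one, one_cross, he.tr_eq]; module

theorem adj_cross (y : A) : S.adj (S.cross e y) = S.T e (S.adj y) • e := by
  have h := S.adj_cross_adj e y
  simpa [he.adj_eq] using h

theorem cross_mul_cross (y z : A) :
    S.cross (S.cross e z) (S.cross e y) = S.T (S.cross e z) y • e := by
  have h := S.cross_cross e y z
  simpa [he.adj_eq] using h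

theorem cross_cross_self (y : A) :
    S.cross e (S.cross e y) = (S.tr y - S.T e y) • (S.one - e) - S.cross e y := by
  have h := he.cross_mul_cross y S.one
  have h2 := S.tr_cross e y
  rw [he.tr_eq] at h2
  rw [cross_one, he.tr_eq, one_smul, map_sub, LinearMap.sub_apply, one_cross, map_sub,
    LinearMap.sub_apply, one_T, h2] at h
  linear_combination (norm := module) -h

theorem U_eq (y : A) : S.U e y = S.T e y • e := by simp [U, he.adj_eq]

theorem U_one_sub (y : A) : S.U (S.one - e) y = S.peirceZero e y := by
  rw [U, peirceZero, he.adj_one_sub, map_sub, LinearMap.sub_apply, one_T]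

theorem peirceOne_mem (y : A) : S.PeirceOne e (S.peirceOne e y) where
  cross_eq := by
    simp only [peirceOne, map_sub, map_add, map_smul, he.cross_cross_self, he.cross_self,
      cross_one, he.tr_eq]
    module
  T_eq := by
    simp only [peirceOne, map_sub, map_add, map_smul, he.T_self, T_one, he.tr_eq, ← T_cross,
      he.cross_self, map_zero, LinearMap.zero_apply, smul_eq_mul]
    ring

theorem tr_peirceZero (y : A) : S.tr (S.peirceZero e y) = S.tr y - S.T e y := by
  rw [peirceZero, map_sub, map_smul, he.tr_one_sub, tr_cross, he.tr_eq, smul_eq_mul]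
  ring

theorem peirceZero_mem (y : A) : S.PeirceZero e (S.peirceZero e y) where
  cross_eq := by
    rw [he.tr_peirceZero]
    simp only [peirceZero, map_sub, map_smul, he.cross_cross_self, he.cross_self,
      cross_one, he.tr_eq]
    module
  T_eq := by
    simp only [peirceZero, map_sub, map_smul, he.T_self, T_one, he.tr_eq, ← T_cross,
      he.cross_self, map_zero, LinearMap.zero_apply, smul_eq_mul]
    ring

theorem tr_of_peirceOne {x : A} (hx : S.PeirceOne e x) : S.tr x = 0 := by
  have h := S.tr_cross e x
  rw [hx.cross_eq, hx.T_eq, he.tr_eq, map_zero] at h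
  linear_combination -h

/-- On A_0(e) the map e × - is x ↦ tr(x)(1 - e) - x, which leaves the adjoint unchanged, while
`adj_cross` puts the adjoint of e × x on the line of e. -/
theorem adj_of_peirceZero {x : A} (hx : S.PeirceZero e x) : S.adj x = S.tr (S.adj x) • e := by
  have h := he.adj_cross x
  rw [hx.cross_eq, adj_sub, adj_smul, he.adj_one_sub, map_smul, LinearMap.smul_apply, map_sub,
    LinearMap.sub_apply, one_cross, hx.cross_eq] at h
  have h' : S.adj x = S.T e (S.adj x) • e := by rw [← h]; module
  have h2 := congrArg S.tr h'
  rw [map_smul, he.tr_eq, smul_eq_mul, mul_one] at h2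
  rw [h2]; exact h'

theorem adj_mem_of_peirceOne {x : A} (hx : S.PeirceOne e x) : S.PeirceZero e (S.adj x) := by
  have h1 : S.T e (S.adj x) • e = 0 := by
    rw [← he.adj_cross, hx.cross_eq, QuadraticMap.map_zero]
  have h2 : S.T e (S.adj x) = 0 := by
    have := congrArg (S.T e) h1
    simpa [he.T_self] using this
  refine ⟨?_, h2⟩
  have h := S.cross_cross x (S.one - e) e
  rw [cross_comm S x e, hx.cross_eq, map_sub (S.cross e), he.cross_self, cross_one, he.tr_eq,
    S.T_comm (S.adj x) e, h2, map_sub (S.T _), T_one, S.T_comm (S.adj x) e, h2, one_smul, sub_zero,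
    map_sub, cross_one, cross_comm] at h
  simp only [map_zero, LinearMap.zero_apply, zero_smul] at h
  linear_combination (norm := module) -h

theorem T_peirceZero_peirceOne {x y : A} (hx : S.PeirceZero e x) (hy : S.PeirceOne e y) :
    S.T x y = 0 := by
  have h : S.T (S.cross e x) y = 0 := by
    rw [cross_comm, T_cross, hy.cross_eq, map_zero]
  rw [hx.cross_eq] at h
  simp only [map_sub, map_smul, LinearMap.sub_apply, LinearMap.smul_apply, one_T, hy.T_eq,
    he.tr_of_peirceOne hy, smul_zero, sub_zero, zero_sub, neg_eq_zero] at h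
  exact h

theorem tr_adj_eq (y : A) : S.tr (S.adj y) = S.tr (S.adj (S.peirceOne e y)) +
    S.tr (S.adj (S.peirceZero e y)) + S.T e y * S.tr (S.peirceZero e y) := by
  conv_lhs => rw [S.eq_peirce e y]
  have h1 := he.peirceOne_mem y
  have h0 := he.peirceZero_mem y
  simp only [adj_add, adj_smul, he.adj_eq, map_add, LinearMap.add_apply, map_smul,
    LinearMap.smul_apply, h1.cross_eq, tr_cross, h0.T_eq, he.tr_eq, he.tr_of_peirceOne h1,
    S.T_comm (S.peirceOne e y), he.T_peirceZero_peirceOne h0 h1, smul_eq_mul, map_zero]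
  ring

/-- The quadratic equation of A_0(e). Its left side involves U and 1 only, so U determines both
traces as coefficients whenever x is independent of 1 - e. -/
theorem U_self_one_of_peirceZero {x : A} (hx : S.PeirceZero e x) :
    S.U x S.one = S.tr x • x - S.tr (S.adj x) • (S.one - e) := by
  rw [U, he.adj_of_peirceZero hx, T_one, map_smul, LinearMap.smul_apply, cross_one, map_smul,
    he.tr_eq, one_smul, smul_eq_mul, mul_one]

/-- The counterpart on A_1(e): the quadratic trace is read off from U alone. -/
theorem U_U_one_of_peirceOne {x : A} (hx : S.PeirceOne e x) :
    S.U e (S.U x S.one) = -(S.tr (S.adj x) • e) := by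
  rw [he.U_eq, U, T_one, he.tr_of_peirceOne hx, cross_one, zero_smul, zero_sub, map_neg, map_sub,
    map_smul, (he.adj_mem_of_peirceOne hx).T_eq, T_one, he.tr_eq, smul_eq_mul]
  module

end IsPrimitive

/-- With U_x 1 = x², this expresses the adjoint by U and the two traces; descent uses it to define ♯
over k. -/
theorem adj_eq_of_U_one (x : A) : S.adj x = S.U x S.one - S.tr x • x + S.tr (S.adj x) • S.one := by
  rw [U, T_one, cross_one]; module

theorem T_eq_of_adj (x y : A) :
    S.T x y = S.tr x * S.tr y - (S.tr (S.adj (x + y)) - S.tr (S.adj x) - S.tr (S.adj y)) := by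
  rw [adj_add, map_add, map_add, tr_cross]; ring

end CubicJordan

/-! ### Nontrivial idempotents have rank one or two. -/

namespace CubicJordan

section

variable {F B : Type*} [Field F] [AddCommGroup B] [Module F B] (S : CubicJordan F B)

theorem tr_one (h : S.one ≠ 0) : S.tr S.one = 3 := by
  have h1 := S.one_cross S.one
  rw [S.cross_self, S.adj_one] at h1
  have h2 : (S.tr S.one - 3) • S.one = 0 := by
    linear_combination (norm := module) -h1
  rcases smul_eq_zero.mp h2 with h3 | h3
  · linear_combination h3
  · exact absurd h3 h

/-- A nontrivial idempotent or its complement has rank one. -/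
theorem isPrimitive_or_of_idempotent (N : B → F)
    (hN : ∀ x y, S.cross (S.adj x) (S.cross x y) = N x • y + S.T (S.adj x) y • x) (e : B)
    (hli : ∀ a b : F, a • e + b • S.one = 0 → a = 0 ∧ b = 0)
    (h1 : S.U e S.one = e) (h2 : S.U e e = e) :
    S.IsPrimitive e ∨ S.IsPrimitive (S.one - e) := by
  have hone : S.one ≠ 0 := by
    intro h
    have := (hli 0 1 (by simp [h])).2
    exact one_ne_zero this
  have h3 := S.tr_one hone
  have hadj : S.adj e = (1 - S.tr e) • e + S.tr (S.adj e) • S.one := by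
    have h := S.adj_eq_of_U_one e
    rw [h1] at h
    linear_combination (norm := module) h
  have hch := hN e S.one
  rw [cross_one, map_sub, map_smul, cross_one, T_one] at hch
  have hee : S.T e e = S.tr e * S.tr e - 2 * S.tr (S.adj e) := by
    have := S.tr_cross e e
    rw [S.cross_self, map_smul, smul_eq_mul] at this
    linear_combination this
  rw [U, hee] at h2
  -- Eliminating e^♯ × e between U_e e = e and the adjoint identity at y = 1 leaves a linear
  -- relation between e and 1, which forces tr(e^♯) = tr(e) - 1.
  have hlin : (S.tr e - S.tr (S.adj e) - 1) • e + N e • S.one = 0 := by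
    linear_combination (norm := module) h2 - hch - S.tr e • hadj
  have hS := (hli _ _ hlin).1
  have htr := congrArg S.tr hadj
  rw [map_add, map_smul, map_smul, h3, smul_eq_mul, smul_eq_mul] at htr
  have hS' : S.tr (S.adj e) = S.tr e - 1 := by linear_combination -hS
  rw [hS'] at htr hadj
  -- Trace of the formula for e^♯, using tr(1) = 3. The root 1 belongs to e of rank one, the root 2
  -- to 1 - e of rank one.
  have hprod : (S.tr e - 1) * (S.tr e - 2) = 0 := by linear_combination htr
  rcases mul_eq_zero.mp hprod with h | h
  · left
    refine ⟨?_, by linear_combination h⟩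
    rw [hadj, show S.tr e = 1 by linear_combination h]
    simp
  · right
    have ht : S.tr e = 2 := by linear_combination h
    rw [ht] at hadj
    refine ⟨?_, ?_⟩
    · rw [adj_sub, S.adj_one, one_cross, hadj, ht]; module
    · rw [map_sub, h3, ht]; norm_num

theorem peirceOne_add (e x y : B) :
    S.peirceOne e (x + y) = S.peirceOne e x + S.peirceOne e y := by
  simp only [peirceOne, map_add]; module

theorem peirceOne_smul (e : B) (c : F) (x : B) :
    S.peirceOne e (c • x) = c • S.peirceOne e x := by
  simp only [peirceOne, map_smul, smul_eq_mul]; module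

end

end CubicJordan

namespace Herm3

open OctonionAlgebra

variable {k : Type*} [Field k] [Infinite k]

/-- If the projection onto A_1(e) vanished, off-diagonal test elements would force every diagonal
entry of e to be 1. Then tr(e) = 1 gives 2 = 0, diagonal test elements kill the off-diagonal
entries, and e = 1 contradicts e^♯ = 0. -/
theorem exists_peirceOne_ne_zero {e : Herm3 k (Zorn k)} (he : (cubicJordan k).IsPrimitive e) :
    ∃ y, (cubicJordan k).peirceOne e y ≠ 0 := by
  by_contra! h
  have hcross : ∀ x y, (cubicJordan k).cross x y = QuadraticMap.polar (adj fun _ => 1) x y :=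
    fun x y => rfl
  have hT : ∀ x y, (cubicJordan k).T x y = traceForm (fun _ => 1) x y := fun x y => rfl
  have htr : ∀ x : Herm3 k (Zorn k), (cubicJordan k).tr x = x.1 0 + x.1 1 + x.1 2 := by
    intro x
    change traceForm (fun _ => 1) (jordan k (Zorn k) fun _ => 1).one x = _
    rw [traceForm_eq, one_eq]
    simp [QuadraticMap.polar]
  have hone : (cubicJordan k).one = (fun _ => 1, fun _ => 0) := rfl
  have key : ∀ (i : Fin 3) (a : Zorn k), (1 - e.1 i) • a =
      (2 * (cubicJordan k).T e (0, Pi.single i a)) • e.2 i := by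
    intro i a
    have h1 := congrFun (congrArg Prod.snd (h (0, Pi.single i a))) i
    have h2 : (cubicJordan k).tr ((0, Pi.single i a) : Herm3 k (Zorn k)) = 0 := by
      rw [htr]; simp
    have h3 : ((cubicJordan k).cross e (0, Pi.single i a)).2 i = -(e.1 i • a) := by
      rw [hcross, polar_adj]
      have : conj k (0 : Zorn k) = 0 := by simp [Zorn.conj_eq, Zorn.ext_iff]
      simp [this]
    simp only [CubicJordan.peirceOne, h2, h3, hone, Prod.snd_add, Prod.snd_sub, Prod.smul_snd,
      Pi.add_apply, Pi.sub_apply, Pi.smul_apply, Pi.single_eq_same, smul_zero, zero_smul,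
      Prod.snd_zero, Pi.zero_apply] at h1
    linear_combination (norm := module) h1
  have hd : ∀ i, e.1 i = 1 := by
    intro i
    by_contra hi
    have hi' : 1 - e.1 i ≠ 0 := fun h0 => hi (by linear_combination -h0)
    -- Two independent octonions a cannot both have a nonzero multiple on the line of the i-th entry
    -- of e.
    have k1 := key i ⟨1, 0, 0, 0⟩
    have k2 := key i ⟨0, 1, 0, 0⟩
    have a1 := congrArg Zorn.a k1
    have b1 := congrArg Zorn.b k1
    have b2 := congrArg Zorn.b k2
    simp only [Zorn.smul_a, Zorn.smul_b, smul_eq_mul, mul_one, mul_zero] at a1 b1 b2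
    rcases mul_eq_zero.mp b1.symm with h0 | h0
    · rw [h0, zero_mul] at a1; exact hi' a1
    · rw [h0, mul_zero] at b2; exact hi' b2
  have h2 : (2 : k) = 0 := by
    have := he.tr_eq
    rw [htr, hd, hd, hd] at this
    linear_combination this
  have hz : ∀ j, e.2 j = 0 := by
    intro j
    have h1 := congrFun (congrArg Prod.snd (h (Pi.single (j + 1) 1, 0))) j
    have h3 : (cubicJordan k).tr ((Pi.single (j + 1) 1, 0) : Herm3 k (Zorn k)) = 1 := by
      rw [htr]; fin_cases j <;> simp
    have h4 : ((cubicJordan k).cross e (Pi.single (j + 1) 1, 0)).2 j = 0 := by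
      rw [hcross, polar_adj]
      have : conj k (0 : Zorn k) = 0 := by simp [Zorn.conj_eq, Zorn.ext_iff]
      simp [this]
    simp only [CubicJordan.peirceOne, h3, h4, h2, hone, Prod.snd_add, Prod.snd_sub, Prod.smul_snd,
      Pi.add_apply, Pi.sub_apply, Pi.smul_apply, smul_zero, zero_smul, zero_mul, one_smul,
      Prod.snd_zero, Pi.zero_apply, zero_add, add_zero, sub_zero] at h1
    exact h1
  have := congrFun (congrArg Prod.fst he.adj_eq) 0
  change (adj (fun _ => 1) e).1 0 = 0 at this
  rw [adj_eq] at this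
  simp [hd, hz] at this

end Herm3

/-! ### Rationality over the base field of a scalar extension. -/

namespace IsBaseChange

variable {k F A B : Type*} [Field k] [Field F] [Algebra k F] [AddCommGroup A] [Module k A]
  [AddCommGroup B] [Module k B] [Module F B] [IsScalarTower k F B] {j : A →ₗ[k] B}
  (hj : IsBaseChange F j)
include hj

theorem exists_dual_apply (f : A →ₗ[k] k) :
    ∃ g : B →ₗ[F] F, ∀ a, g (j a) = algebraMap k F (f a) :=
  ⟨hj.lift ((Algebra.linearMap k F).comp f), fun a => hj.lift_eq _ a⟩

theorem injective_of_field : Function.Injective j := by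
  rw [injective_iff_map_eq_zero]
  intro a ha
  rw [← Module.forall_dual_apply_eq_zero_iff k]
  intro f
  obtain ⟨g, hg⟩ := exists_dual_apply hj f
  have := hg a
  rw [ha, map_zero] at this
  exact (map_eq_zero _).mp this.symm

/-- A k-linear functional nonzero at a extends to an F-linear one, which computes the scalar as a
quotient of elements of k. -/
theorem mem_range_of_smul_eq {a b : A} (ha : a ≠ 0) {c : F} (h : c • j a = j b) :
    ∃ c₀ : k, algebraMap k F c₀ = c := by
  have : ∃ f : Module.Dual k A, f a ≠ 0 := by
    by_contra! h0
    exact ha ((Module.forall_dual_apply_eq_zero_iff k a).mp h0)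
  obtain ⟨f, hf⟩ := this
  obtain ⟨g, hg⟩ := exists_dual_apply hj f
  refine ⟨f b / f a, ?_⟩
  have h1 := congrArg g h
  rw [map_smul, hg, hg, smul_eq_mul] at h1
  have : algebraMap k F (f a) ≠ 0 := by simpa using hf
  rw [map_div₀, div_eq_iff this, h1]

/-- A functional that kills y but not x isolates the first coefficient; the second is then a scalar
between rational vectors. -/
theorem mem_range_of_smul_sub_smul_eq {x y z : A} (hy : y ≠ 0) (hx : x ∉ Submodule.span k {y})
    {c d : F} (h : j z = c • j x - d • j y) :
    (∃ c₀ : k, algebraMap k F c₀ = c) ∧ ∃ d₀ : k, algebraMap k F d₀ = d := by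
  obtain ⟨f, hfx, hfy⟩ := Submodule.exists_le_ker_of_notMem hx
  have hfy : f y = 0 := hfy (Submodule.mem_span_singleton_self y)
  obtain ⟨g, hg⟩ := exists_dual_apply hj f
  have hc : algebraMap k F (f z / f x) = c := by
    have h1 := congrArg g h
    rw [map_sub, map_smul, map_smul, hg, hg, hg, hfy, map_zero, smul_zero, sub_zero,
      smul_eq_mul] at h1
    have : algebraMap k F (f x) ≠ 0 := by simpa using hfx
    rw [map_div₀, div_eq_iff this, h1]
  refine ⟨⟨_, hc⟩, mem_range_of_smul_eq hj hy (b := (f z / f x) • x - z) ?_⟩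
  rw [map_sub, map_smul, h, ← algebraMap_smul F (f z / f x) (j x), hc]
  abel

theorem eq_zero_of_forall_apply {M : Type*} [AddCommGroup M] [Module F M] (g : B →ₗ[F] M)
    (h : ∀ a, g (j a) = 0) (b : B) : g b = 0 := by
  induction b using hj.inductionOn with
  | zero => exact map_zero g
  | tmul a => exact h a
  | smul c b hb => rw [map_smul, hb, smul_zero]
  | add x y hx hy => rw [map_add, hx, hy, add_zero]

end IsBaseChange

/-! ### Descent of the cubic structure to the base field. -/

namespace CubicJordan

variable {k F A B : Type*} [Field k] [Field F] [Algebra k F] [AddCommGroup A] [Module k A]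
  [AddCommGroup B] [Module k B] [Module F B] [IsScalarTower k F B] {j : A →ₗ[k] B}

section

variable (hj : IsBaseChange F j) (S : CubicJordan F B) {o e : A} {V : A → A → A} (ho : j o = S.one)
  (hV : ∀ x y, j (V x y) = S.U (j x) (j y)) (he : S.IsPrimitive (j e))
include hj ho hV he

/-- The generic trace and the quadratic trace take values in `k` on a `k`-form which contains an
idempotent of rank one. -/
theorem tr_mem_range (x : A) : (∃ c : k, algebraMap k F c = S.tr (j x)) ∧
    ∃ d : k, algebraMap k F d = S.tr (S.adj (j x)) := by
  have hinj := IsBaseChange.injective_of_field hj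
  have he0 : e ≠ 0 := by
    rintro rfl
    have := he.tr_eq
    rw [map_zero, map_zero] at this
    exact zero_ne_one this
  have hoe : j (o - e) = S.one - j e := by rw [map_sub, ho]
  have hoe0 : o - e ≠ 0 := by
    intro h
    have := he.adj_one_sub
    rw [← hoe, h, map_zero, QuadraticMap.map_zero] at this
    exact he0 (hinj (by rw [← this, map_zero]))
  obtain ⟨α, hα⟩ : ∃ α : k, algebraMap k F α = S.T (j e) (j x) :=
    IsBaseChange.mem_range_of_smul_eq hj he0 (b := V e x) (by rw [hV, he.U_eq])
  obtain ⟨x0, hx0⟩ : ∃ x0, j x0 = S.peirceZero (j e) (j x) :=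
    ⟨V (o - e) x, by rw [hV, hoe, he.U_one_sub]⟩
  obtain ⟨x1, hx1⟩ : ∃ x1, j x1 = S.peirceOne (j e) (j x) := by
    refine ⟨x - V e x - x0, ?_⟩
    rw [map_sub, map_sub, hV, he.U_eq, hx0]
    linear_combination (norm := module) S.eq_peirce (j e) (j x)
  have m0 := he.peirceZero_mem (j x)
  have m1 := he.peirceOne_mem (j x)
  have h0 : (∃ c : k, algebraMap k F c = S.tr (j x0)) ∧
      ∃ d : k, algebraMap k F d = S.tr (S.adj (j x0)) := by
    -- On multiples of 1 - e the quadratic equation does not determine its two coefficients, but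
    -- there the traces are known outright.
    by_cases hs : x0 ∈ Submodule.span k {o - e}
    · obtain ⟨c, rfl⟩ := Submodule.mem_span_singleton.mp hs
      have hc : j (c • (o - e)) = algebraMap k F c • (S.one - j e) := by
        rw [map_smul, hoe, algebraMap_smul]
      rw [hc]
      refine ⟨⟨c * 2, ?_⟩, ⟨c * c, ?_⟩⟩
      · rw [map_smul, he.tr_one_sub, map_mul, map_ofNat, smul_eq_mul]
      · rw [adj_smul, he.adj_one_sub, map_smul, he.tr_eq, map_mul, smul_eq_mul, mul_one]
    · refine IsBaseChange.mem_range_of_smul_sub_smul_eq hj hoe0 hs (z := V x0 o) ?_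
      rw [hV, ho, hoe, he.U_self_one_of_peirceZero (hx0 ▸ m0)]
  obtain ⟨⟨c, hc⟩, ⟨d, hd⟩⟩ := h0
  obtain ⟨d', hd'⟩ : ∃ d' : k, algebraMap k F d' = S.tr (S.adj (j x1)) := by
    refine IsBaseChange.mem_range_of_smul_eq hj he0 (b := -V e (V x1 o)) ?_
    rw [map_neg, hV, hV, ho, he.U_U_one_of_peirceOne (hx1 ▸ m1), neg_neg]
  rw [hx0] at hc hd
  rw [hx1] at hd'
  refine ⟨⟨c + α, ?_⟩, ⟨d' + d + α * c, ?_⟩⟩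
  · rw [map_add, hc, he.tr_peirceZero, hα]; ring
  · rw [map_add, map_add, map_mul, hc, hd, hd', hα, he.tr_adj_eq (j x)]

/-- Since both traces are k-valued, x^♯ = U_x 1 - tr(x) x + tr(x^♯) 1 and T make sense on A. Every
identity is inherited because j is injective, and nondegeneracy because the image of j spans. -/
theorem exists_descent : ∃ R : CubicJordan k A, R.one = o ∧
    (∀ x, j (R.adj x) = S.adj (j x)) ∧ ∀ x y, algebraMap k F (R.T x y) = S.T (j x) (j y) := by
  have hinj := IsBaseChange.injective_of_field hj
  have halg : Function.Injective (algebraMap k F) := (algebraMap k F).injective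
  choose t ht using fun x => (tr_mem_range hj S ho hV he x).1
  choose s hs using fun x => (tr_mem_range hj S ho hV he x).2
  have hadj : ∀ x, j (V x o - t x • x + s x • o) = S.adj (j x) := by
    intro x
    rw [S.adj_eq_of_U_one, map_add, map_sub, map_smul, map_smul, hV, ho,
      ← algebraMap_smul F (t x) (j x), ← algebraMap_smul F (s x) S.one, ht, hs]
  have hsmul : ∀ (c : k) (x : A), j (c • x) = algebraMap k F c • j x := fun c x => by
    rw [map_smul, algebraMap_smul]
  let adj : QuadraticMap k A A := QuadraticMap.ofPolar (fun x => V x o - t x • x + s x • o)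
    (fun c x => hinj (by
      rw [hadj, hsmul, hsmul, hadj, adj_smul, map_mul]))
    (fun x y z => hinj (by
      simp only [QuadraticMap.polar, hadj, map_sub, map_add]
      exact QuadraticMap.polar_add_left S.adj (j x) (j y) (j z)))
    (fun c x y => hinj (by
      rw [hsmul]
      simp only [QuadraticMap.polar, hadj, map_sub, map_add]
      rw [hsmul]
      exact QuadraticMap.polar_smul_left S.adj _ (j x) (j y)))
  have hadj' : ∀ x, j (adj x) = S.adj (j x) := hadj
  have hcross : ∀ x y, j (adj.polarBilin x y) = S.cross (j x) (j y) := by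
    intro x y
    rw [QuadraticMap.polarBilin_apply_apply, QuadraticMap.polar, map_sub, map_sub, hadj', hadj',
      hadj', map_add]
    rfl
  have hT0 : ∀ x y, algebraMap k F (t x * t y - (s (x + y) - s x - s y)) = S.T (j x) (j y) := by
    intro x y
    rw [S.T_eq_of_adj]
    simp only [map_sub, map_mul, ht, hs, map_add]
  let T : LinearMap.BilinForm k A := LinearMap.mk₂ k
    (fun x y => t x * t y - (s (x + y) - s x - s y))
    (fun x y z => halg (by rw [map_add, hT0, hT0, hT0, map_add, map_add, LinearMap.add_apply]))
    (fun c x y => halg (by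
      rw [smul_eq_mul, map_mul, hT0, hT0, hsmul, map_smul, LinearMap.smul_apply, smul_eq_mul]))
    (fun x y z => halg (by rw [map_add, hT0, hT0, hT0, map_add, map_add]))
    (fun c x y => halg (by
      rw [smul_eq_mul, map_mul, hT0, hT0, hsmul, map_smul, smul_eq_mul]))
  have hT : ∀ x y, algebraMap k F (T x y) = S.T (j x) (j y) := hT0
  refine ⟨⟨o, adj, T, fun x y => halg ?_, fun x hx => hinj ?_, hinj ?_, fun x => hinj ?_,
    fun x y z => halg ?_, fun x y => hinj ?_, fun x y z => hinj ?_⟩, rfl, hadj', hT⟩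
  · rw [hT, hT, S.T_comm]
  · rw [map_zero]
    refine S.T_nondeg _ fun y => ?_
    refine IsBaseChange.eq_zero_of_forall_apply hj (S.T (j x)) (fun a => ?_) y
    rw [← hT, hx, map_zero]
  · rw [hadj', ho, S.adj_one]
  · rw [hcross, map_sub, hsmul, hT, ho, one_cross]; rfl
  · rw [hT, hT, hcross, hcross, T_cross]
  · simp only [map_add, hcross, hadj', hsmul, hT, adj_cross_adj]
  · simp only [map_add, hcross, hadj', hsmul, hT, cross_cross]

end

end CubicJordan

/-! ### Frames of three idempotents and their off-diagonal Peirce spaces. -/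

namespace CubicJordan

variable {k A : Type*} [Field k] [AddCommGroup A] [Module k A] (S : CubicJordan k A)

/-- A complete system of three orthogonal idempotents of rank one. -/
structure Frame where
  e : Fin 3 → A
  prim : ∀ i, S.IsPrimitive (e i)
  cross_e : ∀ i, S.cross (e i) (e (i + 1)) = e (i + 2)
  sum_e : e 0 + e 1 + e 2 = S.one

/-- The quadratic form `-T(x^♯)`; on the off-diagonal Peirce spaces its polar form is `T`. -/
def q : QuadraticForm k A := -(S.tr.compQuadraticMap S.adj)

theorem q_apply (x : A) : S.q x = -S.tr (S.adj x) := rfl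

theorem polar_q (x y : A) : QuadraticMap.polar S.q x y = S.T x y - S.tr x * S.tr y := by
  simp only [QuadraticMap.polar, q_apply, adj_add, map_add, tr_cross]; ring

variable {S}

namespace Frame

open Herm3 (index_one_one index_one_two index_two_one index_two_two)

variable (Φ : S.Frame)

/-- The off-diagonal Peirce space opposite to `e_i`. -/
structure Peirce (i : Fin 3) (a : A) : Prop where
  cross_zero : S.cross (Φ.e i) a = -a
  cross_one : S.cross (Φ.e (i + 1)) a = 0
  cross_two : S.cross (Φ.e (i + 2)) a = 0

/-- The off-diagonal Peirce component opposite to `e_i`. -/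
def comp (i : Fin 3) (x : A) : A :=
  S.T (Φ.e (i + 1)) x • Φ.e (i + 2) + S.T (Φ.e (i + 2)) x • Φ.e (i + 1) - S.cross (Φ.e i) x

theorem cross_e_two (i : Fin 3) : S.cross (Φ.e i) (Φ.e (i + 2)) = Φ.e (i + 1) := by
  have h := Φ.cross_e (i + 2)
  rwa [index_two_one, index_two_two, cross_comm] at h

theorem cross_e_one_two (i : Fin 3) : S.cross (Φ.e (i + 1)) (Φ.e (i + 2)) = Φ.e i := by
  have h := Φ.cross_e (i + 1)
  rwa [index_one_one, index_one_two] at h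

theorem cross_e_two_one (i : Fin 3) : S.cross (Φ.e (i + 2)) (Φ.e (i + 1)) = Φ.e i := by
  rw [cross_comm, cross_e_one_two]

theorem cross_e_two_zero (i : Fin 3) : S.cross (Φ.e (i + 2)) (Φ.e i) = Φ.e (i + 1) := by
  rw [cross_comm, cross_e_two]

theorem T_e_e_one (i : Fin 3) : S.T (Φ.e i) (Φ.e (i + 1)) = 0 := by
  have h := S.tr_cross (Φ.e i) (Φ.e (i + 1))
  rw [cross_e, (Φ.prim _).tr_eq, (Φ.prim _).tr_eq, (Φ.prim _).tr_eq] at h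
  linear_combination h

theorem T_e_e_two (i : Fin 3) : S.T (Φ.e i) (Φ.e (i + 2)) = 0 := by
  have h := Φ.T_e_e_one (i + 2)
  rwa [index_two_one, S.T_comm] at h

theorem one_eq (i : Fin 3) : S.one = Φ.e i + Φ.e (i + 1) + Φ.e (i + 2) := by
  rw [← Φ.sum_e]
  fin_cases i
  · rfl
  · change _ = Φ.e 1 + Φ.e 2 + Φ.e 0; abel
  · change _ = Φ.e 2 + Φ.e 0 + Φ.e 1; abel

theorem tr_eq (i : Fin 3) (x : A) :
    S.tr x = S.T (Φ.e i) x + S.T (Φ.e (i + 1)) x + S.T (Φ.e (i + 2)) x := by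
  rw [← one_T, Φ.one_eq i, map_add, map_add, LinearMap.add_apply, LinearMap.add_apply]

theorem cross_one_cross (i : Fin 3) (x : A) :
    S.cross (Φ.e (i + 1)) (S.cross (Φ.e i) x) = S.T (Φ.e (i + 1)) x • Φ.e i := by
  have h := (Φ.prim i).cross_mul_cross x (Φ.e (i + 2))
  rwa [cross_e_two] at h

theorem cross_two_cross (i : Fin 3) (x : A) :
    S.cross (Φ.e (i + 2)) (S.cross (Φ.e i) x) = S.T (Φ.e (i + 2)) x • Φ.e i := by
  have h := (Φ.prim i).cross_mul_cross x (Φ.e (i + 1))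
  rwa [cross_e] at h

theorem comp_mem (i : Fin 3) (x : A) : Φ.Peirce i (Φ.comp i x) where
  cross_zero := by
    rw [comp, map_sub, map_add, map_smul, map_smul, cross_e, cross_e_two,
      (Φ.prim i).cross_cross_self, Φ.tr_eq i, Φ.one_eq i]
    module
  cross_one := by
    rw [comp, map_sub, map_add, map_smul, map_smul, cross_e_one_two, (Φ.prim _).cross_self,
      cross_one_cross]
    module
  cross_two := by
    rw [comp, map_sub, map_add, map_smul, map_smul, cross_e_two_one, (Φ.prim _).cross_self,
      cross_two_cross]
    module

theorem eq_sum (x : A) : x = S.T (Φ.e 0) x • Φ.e 0 + S.T (Φ.e 1) x • Φ.e 1 +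
    S.T (Φ.e 2) x • Φ.e 2 + Φ.comp 0 x + Φ.comp 1 x + Φ.comp 2 x := by
  have h := S.one_cross x
  rw [← Φ.sum_e, map_add, map_add, LinearMap.add_apply, LinearMap.add_apply, Φ.tr_eq 0] at h
  simp only [comp, show (0 : Fin 3) + 1 = 1 from rfl, show (0 : Fin 3) + 2 = 2 from rfl,
    show (1 : Fin 3) + 1 = 2 from rfl, show (1 : Fin 3) + 2 = 0 from rfl,
    show (2 : Fin 3) + 1 = 0 from rfl, show (2 : Fin 3) + 2 = 1 from rfl] at h ⊢
  linear_combination (norm := module) h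

variable {Φ}

theorem Peirce.T_zero {i : Fin 3} {a : A} (ha : Φ.Peirce i a) : S.T (Φ.e i) a = 0 := by
  rw [← cross_e_one_two, T_cross, ha.cross_two, map_zero]

theorem Peirce.T_one {i : Fin 3} {a : A} (ha : Φ.Peirce i a) : S.T (Φ.e (i + 1)) a = 0 := by
  rw [← cross_e_two_zero, cross_comm, T_cross, ha.cross_two, map_zero]

theorem Peirce.T_two {i : Fin 3} {a : A} (ha : Φ.Peirce i a) : S.T (Φ.e (i + 2)) a = 0 := by
  rw [← cross_e, T_cross, ha.cross_one, map_zero]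

theorem Peirce.tr_eq {i : Fin 3} {a : A} (ha : Φ.Peirce i a) : S.tr a = 0 := by
  rw [Φ.tr_eq i, ha.T_zero, ha.T_one, ha.T_two]; ring

/-- Here a = -(e_i × a), and `adj_cross` puts the adjoint of e_i × a on the line of e_i. -/
theorem Peirce.adj_eq {i : Fin 3} {a : A} (ha : Φ.Peirce i a) : S.adj a = -(S.q a • Φ.e i) := by
  have h := (Φ.prim i).adj_cross a
  rw [ha.cross_zero, adj_neg] at h
  have h2 := congrArg S.tr h
  rw [map_smul, (Φ.prim i).tr_eq, smul_eq_mul, mul_one] at h2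
  rw [q_apply, h2, neg_smul, neg_neg]; exact h

theorem Peirce.add {i : Fin 3} {a b : A} (ha : Φ.Peirce i a) (hb : Φ.Peirce i b) :
    Φ.Peirce i (a + b) :=
  ⟨by rw [map_add, ha.cross_zero, hb.cross_zero]; abel,
   by rw [map_add, ha.cross_one, hb.cross_one, add_zero],
   by rw [map_add, ha.cross_two, hb.cross_two, add_zero]⟩

theorem Peirce.smul {i : Fin 3} {a : A} (c : k) (ha : Φ.Peirce i a) : Φ.Peirce i (c • a) :=
  ⟨by rw [map_smul, ha.cross_zero, smul_neg],
   by rw [map_smul, ha.cross_one, smul_zero],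
   by rw [map_smul, ha.cross_two, smul_zero]⟩

theorem peirce_zero (i : Fin 3) : Φ.Peirce i 0 := ⟨by simp, by simp, by simp⟩

/-- Distinct Peirce spaces are orthogonal for the trace form. -/
theorem Peirce.T_orth {i : Fin 3} {a b : A} (ha : Φ.Peirce i a) (hb : Φ.Peirce (i + 1) b) :
    S.T a b = 0 := by
  have h : S.T (S.cross (Φ.e i) a) b = 0 := by
    have := hb.cross_two
    rw [index_one_two] at this
    rw [cross_comm, T_cross, this, map_zero]
  rw [ha.cross_zero, map_neg, LinearMap.neg_apply, neg_eq_zero] at h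
  exact h

theorem Peirce.T_orth' {i : Fin 3} {a b : A} (ha : Φ.Peirce i a) (hb : Φ.Peirce (i + 2) b) :
    S.T a b = 0 := by
  rw [S.T_comm]
  refine hb.T_orth ?_
  rwa [index_two_one]

/-- The Peirce rule A_i × A_{i+1} ⊆ A_{i+2}: each clause is the full linearization evaluated at two
members of the frame, where nearly all terms vanish. -/
theorem Peirce.cross_mem {i : Fin 3} {a b : A} (ha : Φ.Peirce i a) (hb : Φ.Peirce (i + 1) b) :
    Φ.Peirce (i + 2) (S.cross a b) := by
  have hb0 := hb.cross_zero
  have hb1 := hb.cross_one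
  have hb2 := hb.cross_two
  have tb0 := hb.T_zero
  have tb1 := hb.T_one
  have tb2 := hb.T_two
  rw [index_one_one] at hb1 tb1
  rw [index_one_two] at hb2 tb2
  refine ⟨?_, ?_, ?_⟩
  · have h := S.cross_cross_linearized (Φ.e i) (Φ.e (i + 1)) b a
    rw [cross_e, ha.cross_zero, ha.cross_one, hb0, hb2, ha.T_two, tb1] at h
    simp only [map_neg, LinearMap.neg_apply, map_zero, LinearMap.zero_apply, zero_smul,
      ha.T_orth hb] at h
    linear_combination (norm := module) h
  · have h := S.cross_cross_linearized (Φ.e (i + 1)) (Φ.e (i + 2)) b a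
    rw [cross_e_one_two, ha.cross_two, ha.cross_one, hb0, hb1, ha.T_zero, tb2] at h
    simp only [map_neg, map_zero, LinearMap.zero_apply, zero_smul] at h
    rw [index_two_one]
    linear_combination (norm := module) h
  · have h := S.cross_cross_linearized (Φ.e (i + 2)) (Φ.e i) b a
    rw [cross_e_two_zero, ha.cross_zero, ha.cross_two, hb1, hb2, ha.T_one, tb0] at h
    simp only [map_neg, LinearMap.neg_apply, map_zero, LinearMap.zero_apply, zero_smul,
      ha.T_orth hb] at h
    rw [index_two_two]
    linear_combination (norm := module) h

theorem Peirce.cross_mem' {i : Fin 3} {a b : A} (ha : Φ.Peirce i a) (hb : Φ.Peirce (i + 2) b) :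
    Φ.Peirce (i + 1) (S.cross a b) := by
  have h := hb.cross_mem (by rwa [index_two_one])
  rwa [index_two_two, cross_comm] at h

/-- The linearized adjoint identity at e_i. It makes a × - invertible between Peirce spaces when
q(a) ≠ 0, and plays the role of the alternative law. -/
theorem Peirce.cross_cross {i : Fin 3} {a b : A} (ha : Φ.Peirce i a) (hb : Φ.Peirce (i + 1) b) :
    S.cross a (S.cross a b) = S.q a • b := by
  have h := S.cross_cross a (Φ.e i) b
  have hb2 := hb.cross_two
  have tb2 := hb.T_two
  rw [index_one_two] at hb2 tb2
  have hab : S.T (S.cross a b) (Φ.e i) = 0 := by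
    rw [S.T_comm, ← index_two_one i]
    exact (ha.cross_mem hb).T_one
  rw [cross_comm S b, hb2, ha.adj_eq, cross_comm S a (Φ.e i), ha.cross_zero, hab] at h
  simp only [map_neg, map_smul, LinearMap.neg_apply, LinearMap.smul_apply, tb2, map_zero,
    (Φ.prim i).T_self] at h
  rw [cross_comm S (S.cross a b)] at h
  linear_combination (norm := module) -h

theorem Peirce.cross_cross' {i : Fin 3} {a b : A} (ha : Φ.Peirce i a)
    (hb : Φ.Peirce (i + 2) b) : S.cross a (S.cross a b) = S.q a • b := by
  have h := S.cross_cross a (Φ.e i) b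
  have hb2 := hb.cross_one
  have tb2 := hb.T_one
  rw [index_two_one] at hb2 tb2
  have hab : S.T (S.cross a b) (Φ.e i) = 0 := by
    rw [S.T_comm, ← index_one_two i]
    exact (ha.cross_mem' hb).T_two
  rw [cross_comm S b, hb2, ha.adj_eq, cross_comm S a (Φ.e i), ha.cross_zero, hab] at h
  simp only [map_neg, map_smul, LinearMap.neg_apply, LinearMap.smul_apply, tb2, map_zero,
    (Φ.prim i).T_self] at h
  rw [cross_comm S (S.cross a b)] at h
  linear_combination (norm := module) -h

/-- Compare traces in the identity for a^♯ × b^♯, where both adjoints are multiples of frame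
idempotents. This becomes the composition law of the octonion norm. -/
theorem Peirce.q_cross {i : Fin 3} {a b : A} (ha : Φ.Peirce i a) (hb : Φ.Peirce (i + 1) b) :
    S.q (S.cross a b) = S.q a * S.q b := by
  have h := S.adj_cross_adj a b
  have tb2 := hb.T_two
  rw [index_one_two] at tb2
  rw [ha.adj_eq, hb.adj_eq] at h
  simp only [map_neg, map_smul, LinearMap.neg_apply, LinearMap.smul_apply, cross_e, tb2,
    S.T_comm a, ha.T_one] at h
  have h' := congrArg S.tr h
  simp only [map_add, map_neg, map_smul, (Φ.prim _).tr_eq, smul_eq_mul] at h'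
  rw [q_apply]
  rw [mul_one] at h'
  linear_combination -h'

theorem Peirce.q_cross' {i : Fin 3} {a b : A} (ha : Φ.Peirce i a) (hb : Φ.Peirce (i + 2) b) :
    S.q (S.cross a b) = S.q a * S.q b := by
  have h := hb.q_cross (by rwa [index_two_one])
  rwa [cross_comm, mul_comm] at h

end Frame

end CubicJordan

/-! ### Conjugation in a general octonion algebra. -/

namespace OctonionAlgebra

section

variable {k C : Type*} [Field k] [NonAssocRing C] [Module k C] [OctonionAlgebra k C]

local notation "n" => QuadraticMap.polar (norm (k := k) (C := C))

/-- N(1) is idempotent. If it were 0 the norm would vanish identically, and nondegeneracy would make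
C zero rather than of dimension 8. -/
theorem norm_one : norm (k := k) (1 : C) = 1 := by
  have h := norm_mul (k := k) (1 : C) 1
  rw [mul_one] at h
  by_contra h1
  have h0 : norm (k := k) (1 : C) = 0 := by
    have : norm (k := k) (1 : C) * (norm (k := k) (1 : C) - 1) = 0 := by linear_combination -h
    rcases mul_eq_zero.mp this with h2 | h2
    · exact h2
    · exact absurd (by linear_combination h2) h1
  have hz : ∀ x : C, norm (k := k) x = 0 := fun x => by
    rw [← mul_one x, norm_mul, h0, mul_zero]
  have hC : ∀ x : C, x = 0 := fun x => nondegenerate (k := k) x fun y => by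
    simp [QuadraticMap.polar, hz]
  have : Subsingleton C := ⟨fun x y => by rw [hC x, hC y]⟩
  have h8 := finrank_eq (k := k) (C := C)
  rw [Module.finrank_zero_of_subsingleton] at h8
  exact absurd h8 (by norm_num)

theorem polar_one_one : n 1 1 = 2 := by
  rw [QuadraticMap.polar_self, norm_one]; simp

theorem conj_conj (x : C) : conj k (conj k x) = x := by
  rw [conj, trace]
  conv_lhs => rw [conj]
  rw [QuadraticMap.polar_sub_left, QuadraticMap.polar_smul_left, polar_one_one, trace, smul_eq_mul]
  module

theorem norm_conj (x : C) : norm (k := k) (conj k x) = norm (k := k) x := by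
  rw [conj, sub_eq_add_neg, QuadraticMap.map_add (norm (k := k) (C := C)), QuadraticMap.map_neg,
    QuadraticMap.map_smul, norm_one, QuadraticMap.polar_neg_right, QuadraticMap.polar_smul_left,
    QuadraticMap.polar_comm, trace, smul_eq_mul, smul_eq_mul]
  ring

theorem polar_mul_right (x z y : C) : n (x * y) (z * y) = n x z * norm (k := k) y := by
  simp only [QuadraticMap.polar, ← add_mul, norm_mul]; ring

theorem polar_mul_mul (x z y w : C) : n (x * y) (z * w) + n (x * w) (z * y) = n x z * n y w := by
  have h := polar_mul_right (k := k) x z (y + w)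
  rw [mul_add, mul_add, QuadraticMap.polar_add_left, QuadraticMap.polar_add_right,
    QuadraticMap.polar_add_right, polar_mul_right, polar_mul_right,
    QuadraticMap.map_add (norm (k := k) (C := C))] at h
  linear_combination h

theorem polar_mul_eq_right (x y z : C) : n (x * y) z = n x (z * conj k y) := by
  have h := polar_mul_mul (k := k) x z y 1
  rw [mul_one, mul_one] at h
  rw [conj, mul_sub, mul_smul_comm, mul_one, QuadraticMap.polar_sub_right,
    QuadraticMap.polar_smul_right, trace, smul_eq_mul]
  linear_combination h

theorem polar_mul_eq_left (x y z : C) : n (x * y) z = n y (conj k x * z) := by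
  have h := polar_mul_mul (k := k) x 1 y z
  rw [one_mul, one_mul] at h
  rw [conj, sub_mul, smul_mul_assoc, one_mul, QuadraticMap.polar_sub_right,
    QuadraticMap.polar_smul_right, trace, smul_eq_mul, QuadraticMap.polar_comm _ y (x * z)]
  linear_combination h

theorem polar_conj_left (x z : C) : n (conj k x) z = n (z * x) 1 := by
  rw [polar_mul_eq_right, one_mul, QuadraticMap.polar_comm]

/-- Both sides pair equally with every z, as multiplication by x is adjoint to multiplication by its
conjugate; no associativity enters. -/
theorem conj_mul (x y : C) : conj k (x * y) = conj k y * conj k x := by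
  rw [← sub_eq_zero]
  refine nondegenerate (k := k) _ fun z => ?_
  rw [QuadraticMap.polar_sub_left, polar_conj_left, polar_mul_eq_left z, mul_one,
    polar_mul_eq_right x, polar_mul_eq_right (conj k y), conj_conj, polar_conj_left,
    polar_mul_eq_right _ y, one_mul, polar_mul_eq_left z, sub_self]

end

end OctonionAlgebra

/-! ### Elements as matrices with respect to a frame. -/

namespace CubicJordan

namespace Frame

open Herm3 (index_one_one index_one_two index_two_one index_two_two)

variable {k A : Type*} [Field k] [AddCommGroup A] [Module k A] {S : CubicJordan k A}
  {Φ : S.Frame}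

theorem Peirce.cross_of_add_one {i : Fin 3} {a : A} (ha : Φ.Peirce (i + 1) a) :
    S.cross (Φ.e i) a = 0 := by
  have h := ha.cross_two
  rwa [index_one_two] at h

theorem Peirce.cross_of_add_two {i : Fin 3} {a : A} (ha : Φ.Peirce (i + 2) a) :
    S.cross (Φ.e i) a = 0 := by
  have h := ha.cross_one
  rwa [index_two_one] at h

theorem Peirce.T_of_add_one {i : Fin 3} {a : A} (ha : Φ.Peirce (i + 1) a) :
    S.T (Φ.e i) a = 0 := by
  have h := ha.T_two
  rwa [index_one_two] at h

theorem Peirce.T_of_add_two {i : Fin 3} {a : A} (ha : Φ.Peirce (i + 2) a) :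
    S.T (Φ.e i) a = 0 := by
  have h := ha.T_one
  rwa [index_two_one] at h

variable (Φ) in
/-- The element with diagonal entries `α` and off-diagonal Peirce components `a`. -/
def assemble (α : Fin 3 → k) (a : Fin 3 → A) : A := ∑ i, (α i • Φ.e i + a i)

theorem assemble_eq (α : Fin 3 → k) (a : Fin 3 → A) (i : Fin 3) : Φ.assemble α a =
    (α i • Φ.e i + a i) + (α (i + 1) • Φ.e (i + 1) + a (i + 1)) +
      (α (i + 2) • Φ.e (i + 2) + a (i + 2)) := by
  rw [assemble, Fin.sum_univ_three]
  fin_cases i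
  · rfl
  · change _ = (α 1 • Φ.e 1 + a 1) + (α 2 • Φ.e 2 + a 2) + (α 0 • Φ.e 0 + a 0); abel
  · change _ = (α 2 • Φ.e 2 + a 2) + (α 0 • Φ.e 0 + a 0) + (α 1 • Φ.e 1 + a 1); abel

variable (α β : Fin 3 → k) {a b : Fin 3 → A} (ha : ∀ i, Φ.Peirce i (a i))
  (hb : ∀ i, Φ.Peirce i (b i))

section
include ha

theorem T_assemble (i : Fin 3) : S.T (Φ.e i) (Φ.assemble α a) = α i := by
  rw [Φ.assemble_eq α a i]
  simp only [map_add, map_smul, (Φ.prim i).T_self, T_e_e_one, T_e_e_two, (ha i).T_zero,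
    (ha (i + 1)).T_of_add_one, (ha (i + 2)).T_of_add_two, smul_eq_mul]
  ring

theorem cross_assemble (i : Fin 3) : S.cross (Φ.e i) (Φ.assemble α a) =
    α (i + 1) • Φ.e (i + 2) + α (i + 2) • Φ.e (i + 1) - a i := by
  rw [Φ.assemble_eq α a i]
  simp only [map_add, map_smul, (Φ.prim i).cross_self, cross_e, cross_e_two, (ha i).cross_zero,
    (ha (i + 1)).cross_of_add_one, (ha (i + 2)).cross_of_add_two]
  module

theorem comp_assemble (i : Fin 3) : Φ.comp i (Φ.assemble α a) = a i := by
  rw [comp, T_assemble α ha, T_assemble α ha, cross_assemble α ha]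
  abel

theorem adj_assemble : S.adj (Φ.assemble α a) =
    Φ.assemble (fun i => α (i + 1) * α (i + 2) - S.q (a i))
      (fun i => S.cross (a (i + 1)) (a (i + 2)) - α i • a i) := by
  have e01 : S.cross (Φ.e 0) (Φ.e 1) = Φ.e 2 := Φ.cross_e 0
  have e02 : S.cross (Φ.e 0) (Φ.e 2) = Φ.e 1 := Φ.cross_e_two 0
  have e12 : S.cross (Φ.e 1) (Φ.e 2) = Φ.e 0 := Φ.cross_e 1
  have c01 : S.cross (Φ.e 0) (a 1) = 0 := (ha 1).cross_of_add_one (i := 0)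
  have c02 : S.cross (Φ.e 0) (a 2) = 0 := (ha 2).cross_of_add_two (i := 0)
  have c10 : S.cross (a 0) (Φ.e 1) = 0 := by
    rw [cross_comm]; exact (ha 0).cross_of_add_two (i := 1)
  have c12 : S.cross (Φ.e 1) (a 2) = 0 := (ha 2).cross_of_add_one (i := 1)
  have c20 : S.cross (a 0) (Φ.e 2) = 0 := by
    rw [cross_comm]; exact (ha 0).cross_of_add_one (i := 2)
  have c21 : S.cross (a 1) (Φ.e 2) = 0 := by
    rw [cross_comm]; exact (ha 1).cross_of_add_two (i := 2)
  simp only [assemble, Fin.sum_univ_three, adj_add, adj_smul, map_add, map_smul,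
    LinearMap.add_apply, LinearMap.smul_apply, (Φ.prim _).adj_eq, (ha _).adj_eq,
    (ha _).cross_zero, e01, e02, e12, c01, c02, c10, c12, c20, c21,
    show (0 : Fin 3) + 1 = 1 from rfl, show (0 : Fin 3) + 2 = 2 from rfl,
    show (1 : Fin 3) + 1 = 2 from rfl, show (1 : Fin 3) + 2 = 0 from rfl,
    show (2 : Fin 3) + 1 = 0 from rfl, show (2 : Fin 3) + 2 = 1 from rfl,
    cross_comm S (a 2) (a 0)]
  module

include hb

theorem T_assemble_assemble : S.T (Φ.assemble α a) (Φ.assemble β b) =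
    ∑ i, (α i * β i + S.T (a i) (b i)) := by
  have h1 : ∀ i, S.T (a i) (Φ.assemble β b) = S.T (a i) (b i) := by
    intro i
    have z0 : S.T (a i) (Φ.e i) = 0 := by rw [S.T_comm, (ha i).T_zero]
    have z1 : S.T (a i) (Φ.e (i + 1)) = 0 := by rw [S.T_comm, (ha i).T_one]
    have z2 : S.T (a i) (Φ.e (i + 2)) = 0 := by rw [S.T_comm, (ha i).T_two]
    rw [Φ.assemble_eq β b i]
    simp only [map_add, map_smul, z0, z1, z2, (ha i).T_orth (hb (i + 1)),
      (ha i).T_orth' (hb (i + 2)), smul_zero, add_zero, zero_add]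
  conv_lhs => rw [assemble]
  simp only [map_sum, LinearMap.sum_apply, map_add, map_smul, LinearMap.add_apply,
    LinearMap.smul_apply, T_assemble β hb, h1, smul_eq_mul]

end

theorem eq_assemble (x : A) :
    x = Φ.assemble (fun i => S.T (Φ.e i) x) (fun i => Φ.comp i x) := by
  conv_lhs => rw [Φ.eq_sum x]
  rw [assemble, Fin.sum_univ_three]
  abel

/-- The polarized form of `cross_cross`, used to rebracket products in place of associativity. -/
theorem Peirce.cross_cross_add {i : Fin 3} {p u m : A} (hp : Φ.Peirce i p) (hu : Φ.Peirce i u)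
    (hm : Φ.Peirce (i + 1) m ∨ Φ.Peirce (i + 2) m) :
    S.cross u (S.cross p m) + S.cross p (S.cross u m) = S.T p u • m := by
  have key : ∀ {c}, Φ.Peirce i c → S.cross c (S.cross c m) = S.q c • m := fun hc =>
    hm.elim (fun h => hc.cross_cross h) fun h => hc.cross_cross' h
  have h := key (hp.add hu)
  simp only [map_add, LinearMap.add_apply, key hp, key hu, QuadraticMap.map_add S.q, polar_q,
    hp.tr_eq] at h
  linear_combination (norm := module) h

end Frame

end CubicJordan

/-! ### Jacobson coordinatization: the octonion algebra on the Peirce space opposite e_1. -/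

namespace CubicJordan

namespace Frame

variable {k A : Type*} [Field k] [AddCommGroup A] [Module k A] {S : CubicJordan k A}

/-- A coordinate system for a frame: invertible off-diagonal elements `u₀`, `u₂` and a linear
parametrization `ι` of the Peirce space opposite to `e_1`. -/
structure Coord (Φ : S.Frame) (V : Type*) [AddCommGroup V] [Module k V] where
  u₀ : A
  u₂ : A
  mem₀ : Φ.Peirce 0 u₀
  mem₂ : Φ.Peirce 2 u₂
  q₀ : S.q u₀ ≠ 0
  q₂ : S.q u₂ ≠ 0
  ι : V →ₗ[k] A
  π : A →ₗ[k] V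
  mem : ∀ v, Φ.Peirce 1 (ι v)
  π_ι : ∀ v, π (ι v) = v
  ι_π : ∀ a, Φ.Peirce 1 a → ι (π a) = a
  finrank_eq : Module.finrank k A = 27

namespace Coord

variable {Φ : S.Frame} {V : Type*} [AddCommGroup V] [Module k V] (D : Φ.Coord V)

theorem ι_injective : Function.Injective D.ι := fun v w h => by
  rw [← D.π_ι v, h, D.π_ι]

theorem mem_u₂_ι (v : V) : Φ.Peirce 0 (S.cross D.u₂ (D.ι v)) := D.mem₂.cross_mem' (D.mem v)

theorem mem_ι_u₂ (v : V) : Φ.Peirce 0 (S.cross (D.ι v) D.u₂) := (D.mem v).cross_mem D.mem₂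

theorem mem_ι_u₀ (v : V) : Φ.Peirce 2 (S.cross (D.ι v) D.u₀) := (D.mem v).cross_mem' D.mem₀

theorem mem_mul (v w : V) :
    Φ.Peirce 1 (S.cross (S.cross (D.ι v) D.u₂) (S.cross (D.ι w) D.u₀)) :=
  (D.mem_ι_u₂ v).cross_mem' (D.mem_ι_u₀ w)

theorem mem_one : Φ.Peirce 1 (S.cross D.u₂ D.u₀) := D.mem₂.cross_mem D.mem₀

theorem u₂_u₂ (v : V) : S.cross D.u₂ (S.cross D.u₂ (D.ι v)) = S.q D.u₂ • D.ι v :=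
  D.mem₂.cross_cross' (D.mem v)

theorem u₀_u₀ (v : V) : S.cross D.u₀ (S.cross D.u₀ (D.ι v)) = S.q D.u₀ • D.ι v :=
  D.mem₀.cross_cross (D.mem v)

/-- The scalar `q(u₀) q(u₂)`. -/
def scal : k := S.q D.u₀ * S.q D.u₂

theorem scal_ne_zero : D.scal ≠ 0 := mul_ne_zero D.q₀ D.q₂

/-- The coordinate algebra. -/
@[nolint unusedArguments]
def Alg (_ : Φ.Coord V) : Type _ := V

/-- The product of the coordinate algebra. -/
def mulMap : V →ₗ[k] V →ₗ[k] V :=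
  D.scal⁻¹ • ((S.cross.compl₁₂ ((S.cross.flip D.u₂).comp D.ι)
    ((S.cross.flip D.u₀).comp D.ι)).compr₂ D.π)

theorem ι_mulMap (v w : V) : D.ι (D.mulMap v w) =
    D.scal⁻¹ • S.cross (S.cross (D.ι v) D.u₂) (S.cross (D.ι w) D.u₀) := by
  change D.ι (D.scal⁻¹ • D.π _) = _
  rw [map_smul, D.ι_π]
  · rfl
  · exact D.mem_mul v w

/-- Bracketing u₂ × u₀ with u₂ gives q(u₂) u₀, and u₀ × (u₀ × w) = q(u₀) w; the normalization by
`scal` cancels both factors. -/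
theorem one_mulMap (w : V) : D.mulMap (D.π (S.cross D.u₂ D.u₀)) w = w := by
  apply D.ι_injective
  rw [ι_mulMap, D.ι_π _ D.mem_one, cross_comm S (S.cross D.u₂ D.u₀),
    D.mem₂.cross_cross (i := 2) D.mem₀, map_smul, LinearMap.smul_apply, cross_comm S (D.ι w),
    u₀_u₀, smul_smul, smul_smul, mul_assoc, mul_comm (S.q D.u₂)]
  exact (congrArg (· • D.ι w) (inv_mul_cancel₀ D.scal_ne_zero)).trans (one_smul _ _)

theorem mulMap_one (v : V) : D.mulMap v (D.π (S.cross D.u₂ D.u₀)) = v := by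
  apply D.ι_injective
  rw [ι_mulMap, D.ι_π _ D.mem_one, cross_comm S (S.cross D.u₂ D.u₀), cross_comm S D.u₂,
    D.mem₀.cross_cross' (i := 0) D.mem₂, map_smul, cross_comm S _ D.u₂, cross_comm S (D.ι v),
    u₂_u₂, smul_smul, smul_smul, mul_assoc]
  exact (congrArg (· • D.ι v) (inv_mul_cancel₀ D.scal_ne_zero)).trans (one_smul _ _)

instance : NonAssocRing D.Alg where
  toAddCommGroup := inferInstanceAs (AddCommGroup V)
  mul v w := D.mulMap v w
  one := D.π (S.cross D.u₂ D.u₀)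
  left_distrib x y z := (D.mulMap x).map_add y z
  right_distrib x y z := D.mulMap.map_add₂ x y z
  zero_mul x := D.mulMap.map_zero₂ x
  mul_zero x := (D.mulMap x).map_zero
  one_mul x := D.one_mulMap x
  mul_one x := D.mulMap_one x

instance : Module k D.Alg := inferInstanceAs (Module k V)

/-- The parametrization on the coordinate algebra. -/
def toA : D.Alg →ₗ[k] A := D.ι

theorem toA_mul (v w : D.Alg) : D.toA (v * w) =
    D.scal⁻¹ • S.cross (S.cross (D.toA v) D.u₂) (S.cross (D.toA w) D.u₀) := D.ι_mulMap v w

theorem toA_one : D.toA 1 = S.cross D.u₂ D.u₀ := D.ι_π _ D.mem_one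

theorem mem_toA (v : D.Alg) : Φ.Peirce 1 (D.toA v) := D.mem v

theorem mem_toA_u₂ (v : D.Alg) : Φ.Peirce 0 (S.cross (D.toA v) D.u₂) := D.mem_ι_u₂ v

theorem mem_toA_u₀ (v : D.Alg) : Φ.Peirce 2 (S.cross (D.toA v) D.u₀) := D.mem_ι_u₀ v

theorem u₂_u₂_toA (v : D.Alg) :
    S.cross D.u₂ (S.cross D.u₂ (D.toA v)) = S.q D.u₂ • D.toA v := D.u₂_u₂ v

theorem u₀_u₀_toA (v : D.Alg) :
    S.cross D.u₀ (S.cross D.u₀ (D.toA v)) = S.q D.u₀ • D.toA v := D.u₀_u₀ v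

/-- The norm form of the coordinate algebra. -/
def normForm : QuadraticForm k D.Alg := D.scal⁻¹ • S.q.comp D.toA

theorem normForm_apply (v : D.Alg) : D.normForm v = D.scal⁻¹ * S.q (D.toA v) := rfl

theorem polar_normForm (v w : D.Alg) :
    QuadraticMap.polar D.normForm v w = D.scal⁻¹ * S.T (D.toA v) (D.toA w) := by
  have h := polar_q S (D.toA v) (D.toA w)
  rw [(D.mem_toA v).tr_eq, zero_mul, sub_zero] at h
  rw [← h]
  simp only [QuadraticMap.polar, normForm_apply, map_add]
  ring

/-- The off-diagonal components `(ι₀ x₀, ι₁ x₁, ι₂ x₂)` in terms of coordinates. -/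
def emb : Fin 3 → D.Alg →ₗ[k] A :=
  ![(S.q D.u₂)⁻¹ • (S.cross D.u₂).comp D.toA, D.toA,
    (S.q D.u₀)⁻¹ • (S.cross.flip D.u₀).comp D.toA]

theorem emb_zero (v : D.Alg) : D.emb 0 v = (S.q D.u₂)⁻¹ • S.cross D.u₂ (D.toA v) := rfl
theorem emb_one (v : D.Alg) : D.emb 1 v = D.toA v := rfl
theorem emb_two (v : D.Alg) : D.emb 2 v = (S.q D.u₀)⁻¹ • S.cross (D.toA v) D.u₀ := rfl

theorem mem_emb (i : Fin 3) (v : D.Alg) : Φ.Peirce i (D.emb i v) := by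
  fin_cases i
  · exact (D.mem_u₂_ι v).smul _
  · exact D.mem v
  · exact (D.mem_ι_u₀ v).smul _

theorem emb_injective (i : Fin 3) : Function.Injective (D.emb i) := by
  rw [injective_iff_map_eq_zero]
  intro v hv
  have key : D.toA v = 0 → v = 0 := fun h => D.ι_injective (h.trans (map_zero D.ι).symm)
  apply key
  fin_cases i
  · change (S.q D.u₂)⁻¹ • S.cross D.u₂ (D.ι v) = 0 at hv
    have h := (smul_eq_zero.mp hv).resolve_left (inv_ne_zero D.q₂)
    have h2 := D.u₂_u₂ v
    rw [h, map_zero] at h2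
    exact (smul_eq_zero.mp h2.symm).resolve_left D.q₂
  · exact hv
  · change (S.q D.u₀)⁻¹ • S.cross (D.ι v) D.u₀ = 0 at hv
    have h := (smul_eq_zero.mp hv).resolve_left (inv_ne_zero D.q₀)
    have h2 := D.u₀_u₀ v
    rw [cross_comm S D.u₀ (D.ι v), h, map_zero] at h2
    exact (smul_eq_zero.mp h2.symm).resolve_left D.q₀

theorem emb_surjective (i : Fin 3) {c : A} (hc : Φ.Peirce i c) : ∃ v, D.emb i v = c := by
  fin_cases i
  · refine ⟨(D.π (S.cross D.u₂ c) : V), ?_⟩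
    change (S.q D.u₂)⁻¹ • S.cross D.u₂ (D.ι (D.π (S.cross D.u₂ c))) = c
    rw [D.ι_π _ (D.mem₂.cross_mem (i := 2) hc), D.mem₂.cross_cross (i := 2) hc, smul_smul,
      inv_mul_cancel₀ D.q₂, one_smul]
  · exact ⟨(D.π c : V), D.ι_π c hc⟩
  · refine ⟨(D.π (S.cross D.u₀ c) : V), ?_⟩
    change (S.q D.u₀)⁻¹ • S.cross (D.ι (D.π (S.cross D.u₀ c))) D.u₀ = c
    rw [D.ι_π _ (D.mem₀.cross_mem' (i := 0) hc), cross_comm, D.mem₀.cross_cross' (i := 0) hc,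
      smul_smul, inv_mul_cancel₀ D.q₀, one_smul]

/-- The linear parametrization of the whole algebra by coordinates. -/
def param : ((Fin 3 → k) × (Fin 3 → D.Alg)) →ₗ[k] A where
  toFun x := Φ.assemble x.1 (fun i => D.emb i (x.2 i))
  map_add' x y := by
    simp only [assemble, ← Finset.sum_add_distrib]
    refine Finset.sum_congr rfl fun i _ => ?_
    simp only [Prod.fst_add, Prod.snd_add, Pi.add_apply, map_add]
    module
  map_smul' c x := by
    simp only [assemble, Finset.smul_sum]
    refine Finset.sum_congr rfl fun i _ => ?_
    simp only [Prod.smul_fst, Prod.smul_snd, Pi.smul_apply, map_smul, smul_eq_mul,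
      RingHom.id_apply]
    module

theorem param_apply (x : (Fin 3 → k) × (Fin 3 → D.Alg)) :
    D.param x = Φ.assemble x.1 (fun i => D.emb i (x.2 i)) := rfl

theorem param_bijective : Function.Bijective D.param := by
  constructor
  · rw [injective_iff_map_eq_zero]
    intro x hx
    rw [param_apply] at hx
    have hm := fun i => D.mem_emb i (x.2 i)
    refine Prod.ext (funext fun i => ?_) (funext fun i => ?_)
    · have h := T_assemble x.1 hm i
      rw [hx, map_zero] at h
      exact h.symm
    · have h := comp_assemble x.1 hm i
      rw [hx] at h
      refine D.emb_injective i ?_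
      rw [← h]
      simp [comp]
  · intro a
    choose v hv using fun i => D.emb_surjective i (Φ.comp_mem i a)
    refine ⟨(fun i => S.T (Φ.e i) a, v), ?_⟩
    rw [param_apply]
    simp only [hv]
    exact (eq_assemble a).symm

/-- The three off-diagonal spaces have equal dimension d, and 27 = 3 + 3d. -/
theorem finrank_alg : Module.finrank k D.Alg = 8 := by
  have hA := D.finrank_eq
  have hfin : Module.Finite k A := Module.finite_of_finrank_pos (by rw [hA]; norm_num)
  have hfinV : Module.Finite k D.Alg :=
    Module.Finite.of_injective D.toA D.ι_injective
  have h := (LinearEquiv.ofBijective D.param D.param_bijective).finrank_eq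
  rw [hA, Module.finrank_prod, Module.finrank_pi, Module.finrank_pi_fintype] at h
  simp at h
  omega

/-- The composition law is `q_cross` applied three times. Nondegeneracy comes from T, because A_1 is
orthogonal to all other Peirce components. -/
instance : OctonionAlgebra k D.Alg where
  smul_assoc c x y := D.mulMap.map_smul₂ c x y
  smul_comm c x y := ((D.mulMap x).map_smul c y).symm
  norm := D.normForm
  norm_mul x y := by
    rw [normForm_apply, normForm_apply, normForm_apply, toA_mul, QuadraticMap.map_smul,
      (D.mem_toA_u₂ x).q_cross' (i := 0) (D.mem_toA_u₀ y),
      (D.mem_toA x).q_cross (i := 1) D.mem₂, (D.mem_toA y).q_cross' (i := 1) D.mem₀, smul_eq_mul]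
    have h0 := D.q₀
    have h2 := D.q₂
    rw [scal]
    field_simp
  nondegenerate x h := by
    have h0 : S.T (D.toA x) = 0 := by
      ext y
      have hx := D.mem_toA x
      obtain ⟨w, hw⟩ := D.emb_surjective 1 (Φ.comp_mem 1 y)
      have h1 : S.T (D.toA x) (Φ.comp 1 y) = 0 := by
        have := h w
        rw [polar_normForm] at this
        rw [← hw]
        exact (mul_eq_zero.mp this).resolve_left (inv_ne_zero D.scal_ne_zero)
      have e0 : S.T (D.toA x) (Φ.e 0) = 0 := by rw [S.T_comm]; exact hx.T_two (i := 1)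
      have e1 : S.T (D.toA x) (Φ.e 1) = 0 := by rw [S.T_comm]; exact hx.T_zero (i := 1)
      have e2 : S.T (D.toA x) (Φ.e 2) = 0 := by rw [S.T_comm]; exact hx.T_one (i := 1)
      rw [Φ.eq_sum y]
      simp only [map_add, map_smul, e0, e1, e2, h1, hx.T_orth (i := 1) (Φ.comp_mem 2 y),
        hx.T_orth' (i := 1) (Φ.comp_mem 0 y), smul_zero, add_zero, LinearMap.zero_apply]
    have h2 : D.toA x = 0 := S.T_nondeg _ fun y => by rw [h0]; rfl
    exact D.ι_injective (h2.trans (map_zero D.ι).symm)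
  finrank_eq := D.finrank_alg

open OctonionAlgebra

theorem norm_eq (v : D.Alg) : norm (k := k) v = D.scal⁻¹ * S.q (D.toA v) := rfl

theorem toA_conj (v : D.Alg) : D.toA (conj k v) =
    (D.scal⁻¹ * S.T (D.toA v) (S.cross D.u₂ D.u₀)) • S.cross D.u₂ D.u₀ - D.toA v := by
  rw [conj, map_sub, map_smul, toA_one, trace]
  congr 2
  rw [← toA_one]
  exact D.polar_normForm v 1

/-- The diagonal matrix of the coordinatized algebra. -/
def Γ : Fin 3 → k := ![S.q D.u₂, 1, S.q D.u₀]

theorem q_emb (i : Fin 3) (v : D.Alg) :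
    S.q (D.emb i v) = D.Γ (i + 1) * D.Γ (i + 2) * norm (k := k) v := by
  have h0 := D.q₀
  have h2 := D.q₂
  rw [norm_eq]
  fin_cases i
  · change S.q ((S.q D.u₂)⁻¹ • S.cross D.u₂ (D.toA v)) = 1 * S.q D.u₀ * _
    rw [QuadraticMap.map_smul, D.mem₂.q_cross' (i := 2) (D.mem_toA v), scal, smul_eq_mul]
    field_simp
  · change S.q (D.toA v) = S.q D.u₀ * S.q D.u₂ * _
    rw [scal]
    field_simp
  · change S.q ((S.q D.u₀)⁻¹ • S.cross (D.toA v) D.u₀) = S.q D.u₂ * 1 * _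
    rw [QuadraticMap.map_smul, (D.mem_toA v).q_cross' (i := 1) D.mem₀, scal, smul_eq_mul]
    field_simp

theorem cross_u₂_u₂_u₀ : S.cross D.u₂ (S.cross D.u₂ D.u₀) = S.q D.u₂ • D.u₀ :=
  D.mem₂.cross_cross (i := 2) D.mem₀

theorem cross_u₀_u₂_u₀ : S.cross D.u₀ (S.cross D.u₂ D.u₀) = S.q D.u₀ • D.u₂ := by
  rw [cross_comm S D.u₂]
  exact D.mem₀.cross_cross' (i := 0) D.mem₂

/-- Rebracket with `cross_cross_add` for the pair v × u₂, u₀. The extra term T(v × u₂, u₀) = T(v, u₂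
× u₀) is, up to `scal`, the trace of v and accounts for the conjugation. -/
theorem cross_emb_zero_one (v w : D.Alg) : S.cross (D.emb 0 (conj k v)) (D.emb 1 w) =
    S.q D.u₀ • D.emb 2 (v * w) := by
  have h0 := D.q₀
  have h2 := D.q₂
  have h := (D.mem_toA_u₂ v).cross_cross_add D.mem₀ (Or.inr (D.mem_toA_u₀ w))
  have hu := D.u₀_u₀_toA w
  rw [cross_comm S (D.toA w) D.u₀, hu, T_cross, map_smul, cross_comm S D.u₀ (S.cross _ _)] at h
  rw [emb_zero, emb_one, emb_two, toA_mul, toA_conj, cross_comm S (D.toA w) D.u₀]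
  simp only [map_smul, map_sub, LinearMap.smul_apply, LinearMap.sub_apply, cross_u₂_u₂_u₀]
  rw [cross_comm S D.u₂ (D.toA v)]
  rw [eq_sub_of_add_eq h, scal]
  match_scalars <;> field_simp

theorem cross_emb_one_two (v w : D.Alg) : S.cross (D.emb 1 v) (D.emb 2 (conj k w)) =
    S.q D.u₂ • D.emb 0 (v * w) := by
  have h0 := D.q₀
  have h2 := D.q₂
  have h := (D.mem_toA_u₀ w).cross_cross_add D.mem₂ (Or.inl (D.mem_toA_u₂ v))
  have hu := D.u₂_u₂_toA v
  rw [cross_comm S (D.toA v) D.u₂, hu, T_cross, map_smul, cross_comm S (S.cross (D.toA w) D.u₀),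
    cross_comm S D.u₀ D.u₂] at h
  rw [emb_zero, emb_one, emb_two, toA_mul, toA_conj, cross_comm S _ D.u₀]
  simp only [map_smul, map_sub, cross_u₀_u₂_u₀]
  rw [cross_comm S D.u₀ (D.toA w), cross_comm S (D.toA v) D.u₂, eq_sub_of_add_eq h,
    cross_comm S (D.toA v), scal]
  match_scalars <;> field_simp

theorem cross_emb_two_zero (v w : D.Alg) : S.cross (D.emb 2 (conj k v)) (D.emb 0 (conj k w)) =
    D.emb 1 (conj k (v * w)) := by
  rw [OctonionAlgebra.conj_mul, emb_zero, emb_one, emb_two, toA_mul, scal]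
  simp only [map_smul, LinearMap.smul_apply]
  rw [cross_comm S (S.cross _ _), cross_comm S D.u₂, smul_smul, mul_inv,
    mul_comm (S.q D.u₂)⁻¹]

end Coord

end Frame

end CubicJordan

/-! ### The isomorphism with hermitian matrices. -/

namespace CubicJordan

variable {k A : Type*} [Field k] [AddCommGroup A] [Module k A] {S : CubicJordan k A}

namespace Frame

namespace Coord

variable {Φ : S.Frame} {V : Type*} [AddCommGroup V] [Module k V] (D : Φ.Coord V)

open OctonionAlgebra

/-- Conjugation on the entries opposite to `e_0` and `e_2`. -/
def twist : Fin 3 → D.Alg →ₗ[k] D.Alg :=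
  ![{ toFun := conj k, map_add' := conj_add k, map_smul' := conj_smul k }, LinearMap.id,
    { toFun := conj k, map_add' := conj_add k, map_smul' := conj_smul k }]

theorem twist_twist (i : Fin 3) (v : D.Alg) : D.twist i (D.twist i v) = v := by
  fin_cases i
  · exact conj_conj v
  · rfl
  · exact conj_conj v

theorem norm_twist (i : Fin 3) (v : D.Alg) : norm (k := k) (D.twist i v) = norm (k := k) v := by
  fin_cases i
  · exact norm_conj v
  · rfl
  · exact norm_conj v

/-- The twist merges three different product rules into the cyclic rule γ_i conj(x_j x_l) of the
matrix adjoint. -/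
theorem cross_emb_twist (i : Fin 3) (v w : D.Alg) :
    S.cross (D.emb (i + 1) (D.twist (i + 1) v)) (D.emb (i + 2) (D.twist (i + 2) w)) =
      D.Γ i • D.emb i (D.twist i (conj k (v * w))) := by
  fin_cases i
  · change S.cross (D.emb 1 v) (D.emb 2 (conj k w)) = S.q D.u₂ • D.emb 0 (conj k (conj k (v * w)))
    rw [cross_emb_one_two, conj_conj]
  · change S.cross (D.emb 2 (conj k v)) (D.emb 0 (conj k w)) = (1 : k) • D.emb 1 (conj k (v * w))
    rw [cross_emb_two_zero, one_smul]
  · change S.cross (D.emb 0 (conj k v)) (D.emb 1 w) = S.q D.u₀ • D.emb 2 (conj k (conj k (v * w)))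
    rw [cross_emb_zero_one, conj_conj]

/-- The parametrization of the algebra by hermitian matrices over the coordinate algebra. -/
def hermMap : Herm3 k D.Alg →ₗ[k] A :=
  D.param.comp (LinearMap.prodMap LinearMap.id (LinearMap.piMap D.twist))

theorem hermMap_apply (x : Herm3 k D.Alg) :
    D.hermMap x = Φ.assemble x.1 (fun i => D.emb i (D.twist i (x.2 i))) := rfl

theorem hermMap_bijective : Function.Bijective D.hermMap := by
  refine D.param_bijective.comp (Function.Involutive.bijective fun x => ?_)
  refine Prod.ext rfl (funext fun i => ?_)
  exact D.twist_twist i (x.2 i)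

theorem adj_hermMap (x : Herm3 k D.Alg) :
    S.adj (D.hermMap x) = D.hermMap (Herm3.adj D.Γ x) := by
  rw [hermMap_apply, adj_assemble _ fun i => D.mem_emb i _, hermMap_apply, Herm3.adj_apply]
  congr 1
  · funext i
    rw [q_emb, norm_twist]
  · funext i
    simp only [cross_emb_twist, map_sub, map_smul]

theorem T_hermMap (x y : Herm3 k D.Alg) :
    S.T (D.hermMap x) (D.hermMap y) = Herm3.traceForm D.Γ x y := by
  rw [hermMap_apply, hermMap_apply, T_assemble_assemble _ _ (fun i => D.mem_emb i _)
    fun i => D.mem_emb i _, Herm3.traceForm_apply]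
  refine Finset.sum_congr rfl fun i _ => ?_
  have h := polar_q S (D.emb i (D.twist i (x.2 i))) (D.emb i (D.twist i (y.2 i)))
  rw [(D.mem_emb i _).tr_eq, zero_mul, sub_zero] at h
  rw [← h]
  simp only [QuadraticMap.polar, ← map_add, q_emb, norm_twist]
  ring

theorem hermMap_one : D.hermMap (Herm3.jordan k D.Alg D.Γ).one = S.one := by
  change Φ.assemble (fun _ => 1) (fun i => D.emb i (D.twist i 0)) = _
  rw [assemble, Fin.sum_univ_three, ← Φ.sum_e]
  simp only [map_zero, one_smul, add_zero]

theorem hermMap_U (x y : Herm3 k D.Alg) :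
    D.hermMap ((Herm3.jordan k D.Alg D.Γ).U x y) = S.U (D.hermMap x) (D.hermMap y) := by
  have hc : ∀ z w, D.hermMap (QuadraticMap.polar (Herm3.adj D.Γ) z w) =
      S.cross (D.hermMap z) (D.hermMap w) := fun z w => by
    simp only [QuadraticMap.polar, map_sub, ← adj_hermMap, map_add]
    rfl
  rw [Herm3.jordan_U, U, map_sub, map_smul, hc, adj_hermMap, T_hermMap]

end Coord

/-- Every frame with an invertible pair of off-diagonal elements admits coordinates on a finite
power of the base field. -/
theorem exists_coord (Φ : S.Frame) (hA : Module.finrank k A = 27) {u₀ u₂ : A}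
    (h₀ : Φ.Peirce 0 u₀) (h₂ : Φ.Peirce 2 u₂) (q₀ : S.q u₀ ≠ 0) (q₂ : S.q u₂ ≠ 0) :
    ∃ (m : ℕ) (D : Φ.Coord (Fin m → k)), D.u₀ = u₀ ∧ D.u₂ = u₂ := by
  let P : Submodule k A :=
    { carrier := {a | Φ.Peirce 1 a}
      add_mem' := fun ha hb => ha.add hb
      zero_mem' := peirce_zero 1
      smul_mem' := fun c _ ha => ha.smul c }
  have : Module.Finite k A := Module.finite_of_finrank_pos (by rw [hA]; norm_num)
  -- Coordinates in `Fin m → k` place the octonion algebra in the universe of k, whatever the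
  -- universe of A.
  let b := (Module.finBasis k P).equivFun
  let ι : (Fin (Module.finrank k P) → k) →ₗ[k] A := P.subtype.comp b.symm.toLinearMap
  have hι : LinearMap.ker ι = ⊥ := LinearMap.ker_eq_bot.mpr
    ((Subtype.val_injective).comp b.symm.injective)
  obtain ⟨π, hπ⟩ := LinearMap.exists_leftInverse_of_injective ι hι
  have hπι : ∀ v, π (ι v) = v := fun v => LinearMap.congr_fun hπ v
  refine ⟨_, ⟨u₀, u₂, h₀, h₂, q₀, q₂, ι, π, fun v => (b.symm v).2, hπι, fun a ha => ?_, hA⟩,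
    rfl, rfl⟩
  have : ι (b ⟨a, ha⟩) = a := by simp [ι]
  rw [← this, hπι]

end Frame

/-! ### Construction of the frame and of the invertible elements. -/

section

variable {e : A} (he : S.IsPrimitive e)
include he

/-- If T(x^♯) vanished on A_1(e), its polarization would make T vanish there, and a nonzero element
of A_1(e) would lie in the radical of T. -/
theorem IsPrimitive.exists_tr_adj_ne_zero {y : A} (hy : S.peirceOne e y ≠ 0) :
    ∃ x, S.PeirceOne e x ∧ S.tr (S.adj x) ≠ 0 := by
  by_contra! h
  have hx := he.peirceOne_mem y
  apply hy
  refine S.T_nondeg _ fun z => ?_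
  have h1 := he.peirceOne_mem z
  have hsum := h (S.peirceOne e y + S.peirceOne e z)
    ⟨by rw [map_add, hx.cross_eq, h1.cross_eq, add_zero],
     by rw [map_add, hx.T_eq, h1.T_eq, add_zero]⟩
  rw [adj_add, map_add, map_add, h _ hx, h _ h1, tr_cross, he.tr_of_peirceOne hx] at hsum
  rw [S.eq_peirce e z, map_add, map_add, map_smul, S.T_comm _ e, hx.T_eq, S.T_comm _ (S.peirceZero e z),
    he.T_peirceZero_peirceOne (he.peirceZero_mem z) hx, smul_zero]
  linear_combination -hsum

/-- An element `x` of `A_1(e)` with `T(x^♯) ≠ 0` completes `e` to a frame. -/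
theorem IsPrimitive.exists_frame {x : A} (hx : S.PeirceOne e x) (hx' : S.tr (S.adj x) ≠ 0)
    (hN : ∃ c : k, S.adj (S.adj x) = c • x) : ∃ Φ : S.Frame, Φ.e 0 = e := by
  have h0 := he.adj_mem_of_peirceOne hx
  -- x^♯♯ lies on the line of e, as x^♯ is in A_0(e), and also on the line of x, which T(e, -)
  -- annihilates.
  have hadj : S.adj (S.adj x) = 0 := by
    obtain ⟨c, hc⟩ := hN
    have h := he.adj_of_peirceZero h0
    have h2 := congrArg (S.T e) (h.symm.trans hc)
    rw [map_smul, map_smul, he.T_self, hx.T_eq, smul_zero, smul_eq_mul, mul_one] at h2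
    rw [h, h2, zero_smul]
  set p := (S.tr (S.adj x))⁻¹ • S.adj x with hp
  have hprim : S.IsPrimitive p :=
    ⟨by rw [hp, adj_smul, hadj, smul_zero], by rw [hp, map_smul, smul_eq_mul, inv_mul_cancel₀ hx']⟩
  have hep : S.cross e p = S.one - e - p := by
    rw [hp, map_smul, h0.cross_eq, smul_sub, smul_smul, inv_mul_cancel₀ hx', one_smul]
  have hr : S.IsPrimitive (S.one - e - p) := by
    refine ⟨?_, ?_⟩
    · rw [adj_sub, he.adj_one_sub, hprim.adj_eq, map_sub, LinearMap.sub_apply, one_cross,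
        hprim.tr_eq, hep]
      module
    · rw [map_sub, he.tr_one_sub, hprim.tr_eq]; norm_num
  refine ⟨⟨![e, p, S.one - e - p], fun i => ?_, fun i => ?_, ?_⟩, rfl⟩
  · fin_cases i
    · exact he
    · exact hprim
    · exact hr
  · fin_cases i
    · exact hep
    · change S.cross p (S.one - e - p) = e
      rw [map_sub, map_sub, cross_one, hprim.tr_eq, hprim.cross_self, cross_comm S p e, hep]
      module
    · change S.cross (S.one - e - p) e = p
      rw [map_sub, map_sub, LinearMap.sub_apply, LinearMap.sub_apply, one_cross, he.tr_eq,
        he.cross_self, cross_comm S p e, hep]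
      module
  · change e + p + (S.one - e - p) = S.one
    abel

end

namespace Frame

variable {Φ : S.Frame}

/-- Write x = x_1 + x_2 with q(x) = q(x_1) + q(x_2) ≠ 0. Either x_2 serves, or q(x_1) ≠ 0 and u₀ ×
x_1 serves. -/
theorem exists_mem_two_of_peirceOne {x u₀ : A} (hx : S.PeirceOne (Φ.e 0) x)
    (hx' : S.tr (S.adj x) ≠ 0) (h₀ : Φ.Peirce 0 u₀) (q₀ : S.q u₀ ≠ 0) :
    ∃ u₂, Φ.Peirce 2 u₂ ∧ S.q u₂ ≠ 0 := by
  have hm := fun i => Φ.comp_mem i x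
  have hα : S.T (Φ.e 0) x = 0 := hx.T_eq
  have hc := cross_assemble (fun i => S.T (Φ.e i) x) hm 0
  rw [← eq_assemble, hx.cross_eq] at hc
  have hT : ∀ i, S.T (Φ.e i) (Φ.e i) = 1 := fun i => (Φ.prim i).T_self
  have h1 := congrArg (S.T (Φ.e 2)) hc
  have h2 := congrArg (S.T (Φ.e 1)) hc
  have z21 : S.T (Φ.e 2) (Φ.e 1) = 0 := Φ.T_e_e_two 2
  have z12 : S.T (Φ.e 1) (Φ.e 2) = 0 := Φ.T_e_e_one 1
  have z2c : S.T (Φ.e 2) (Φ.comp 0 x) = 0 := (hm 0).T_two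
  have z1c : S.T (Φ.e 1) (Φ.comp 0 x) = 0 := (hm 0).T_one
  simp only [zero_add, map_zero, map_sub, map_add, map_smul, hT, z21, z12, z2c, z1c, smul_eq_mul,
    mul_one, mul_zero, add_zero, sub_zero] at h1 h2
  simp only [zero_add, ← h1, ← h2, zero_smul, zero_sub] at hc
  have hc0 : Φ.comp 0 x = 0 := by rw [← neg_eq_zero]; exact hc.symm
  have hq : S.q x = S.q (Φ.comp 1 x) + S.q (Φ.comp 2 x) := by
    have hx2 := Φ.eq_sum x
    rw [hα, ← h1, ← h2, hc0] at hx2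
    simp only [zero_smul, zero_add] at hx2
    conv_lhs => rw [hx2]
    rw [QuadraticMap.map_add S.q, polar_q, (hm 1).T_orth (hm 2), (hm 1).tr_eq]
    ring
  by_cases h : S.q (Φ.comp 2 x) = 0
  · refine ⟨S.cross u₀ (Φ.comp 1 x), h₀.cross_mem (i := 0) (hm 1), ?_⟩
    rw [h₀.q_cross (i := 0) (hm 1)]
    refine mul_ne_zero q₀ fun h3 => hx' ?_
    rw [h3, h, q_apply] at hq
    linear_combination -hq
  · exact ⟨_, hm 2, h⟩

/-- As w^♯ is tr(w^♯) e_0, its e_0-entry is the determinant w_1 w_2 - q(w_0) of the block. -/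
theorem q_comp_zero_of_peirceZero {w : A} (hw : S.PeirceZero (Φ.e 0) w) :
    S.q (Φ.comp 0 w) =
      S.T (Φ.e 1) w * (S.tr w - S.T (Φ.e 1) w) - S.tr (S.adj w) := by
  have hm := fun i => Φ.comp_mem i w
  have h := (Φ.prim 0).adj_of_peirceZero hw
  have h1 := congrArg (S.T (Φ.e 0)) h
  rw [map_smul, (Φ.prim 0).T_self, smul_eq_mul, mul_one] at h1
  have h2 := adj_assemble (fun i => S.T (Φ.e i) w) hm
  rw [← eq_assemble] at h2
  have h3 := congrArg (S.T (Φ.e 0)) h2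
  rw [T_assemble] at h3
  · have ht := Φ.tr_eq 0 w
    rw [hw.T_eq] at ht
    rw [h1] at h3
    simp only [zero_add] at h3 ht
    linear_combination h3 - S.T (Φ.e 1) w * ht
  · intro i
    have m1 : Φ.Peirce i (S.cross (Φ.comp (i + 1) w) (Φ.comp (i + 2) w)) := by
      have := (hm (i + 1)).cross_mem (b := Φ.comp (i + 2) w)
        (by rw [Herm3.index_one_one]; exact hm _)
      rwa [Herm3.index_one_two] at this
    rw [sub_eq_add_neg, ← neg_smul]
    exact m1.add ((hm i).smul _)

end Frame

end CubicJordan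

/-! ### Arithmetic of the quadratic extension. -/

/-- A generator `θ` of a separable quadratic extension with `θ² = tθ - n`, together with the
resulting formulas for norm, trace and discriminant. -/
structure QuadraticGenerator (k : Type*) {K : Type*} [Field k] [Field K] [Algebra k K]
    (δ : k) where
  θ : K
  t : k
  n : k
  c : k
  c_ne_zero : c ≠ 0
  sq : θ * θ = t • θ - n • (1 : K)
  exists_eq : ∀ x : K, ∃ p q : k, x = p • (1 : K) + q • θ
  indep : ∀ p q : k, p • (1 : K) + q • θ = 0 → p = 0 ∧ q = 0
  trace_eq : ∀ p q : k, Algebra.trace k K (p • 1 + q • θ) = 2 * p + q * t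
  norm_eq : ∀ p q : k, Algebra.norm k (p • (1 : K) + q • θ) = p ^ 2 + p * q * t + q ^ 2 * n
  discr_eq : δ = c ^ 2 * (t ^ 2 - 4 * n)
  discr_ne_zero : t ^ 2 - 4 * n ≠ 0

theorem exists_quadraticGenerator {k K : Type*} [Field k] [Field K] [Algebra k K]
    [Algebra.IsSeparable k K] (hK : Module.finrank k K = 2) (δ : k)
    (hδ : ∃ b : Module.Basis (Fin 2) k K, Algebra.discr k b = δ) :
    Nonempty (QuadraticGenerator k (K := K) δ) := by
  have : Module.Finite k K := Module.finite_of_finrank_pos (by rw [hK]; norm_num)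
  obtain ⟨θ, hθ⟩ : ∃ θ : K, θ ∉ Submodule.span k {(1 : K)} := by
    by_contra! h
    have := finrank_le_one (R := k) (1 : K) fun w => Submodule.mem_span_singleton.mp (h w)
    omega
  have hli : LinearIndependent k ![(1 : K), θ] := by
    rw [LinearIndependent.pair_iff' one_ne_zero]
    exact fun a ha => hθ (Submodule.mem_span_singleton.mpr ⟨a, ha⟩)
  let b : Module.Basis (Fin 2) k K :=
    basisOfLinearIndependentOfCardEqFinrank hli (by rw [hK]; simp)
  have hb : ⇑b = ![(1 : K), θ] := coe_basisOfLinearIndependentOfCardEqFinrank hli _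
  have hb0 : b 0 = 1 := by rw [hb]; rfl
  have hb1 : b 1 = θ := by rw [hb]; rfl
  have hex : ∀ x : K, ∃ p q : k, x = p • (1 : K) + q • θ := fun x =>
    ⟨b.repr x 0, b.repr x 1, by
      conv_lhs => rw [← b.sum_repr x]
      rw [Fin.sum_univ_two, hb0, hb1]⟩
  have hind : ∀ p q : k, p • (1 : K) + q • θ = 0 → p = 0 ∧ q = 0 := fun p q h =>
    LinearIndependent.pair_iff.mp hli p q h
  obtain ⟨n', t, hsq⟩ := hex (θ * θ)
  have hrepr : ∀ p q : k, b.repr (p • (1 : K) + q • θ) = Finsupp.single 0 p + Finsupp.single 1 q := by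
    intro p q
    rw [← hb0, ← hb1]
    simp
  have hmat : ∀ p q : k, Algebra.leftMulMatrix b (p • (1 : K) + q • θ) =
      !![p, q * n'; q, p + q * t] := by
    intro p q
    have h0 : (p • (1 : K) + q • θ) * b 0 = p • (1 : K) + q • θ := by rw [hb0, mul_one]
    have h1 : (p • (1 : K) + q • θ) * b 1 = (q * n') • (1 : K) + (p + q * t) • θ := by
      rw [hb1, add_mul, smul_mul_assoc, smul_mul_assoc, hsq, one_mul]; module
    ext i l
    rw [Algebra.leftMulMatrix_eq_repr_mul]
    fin_cases l
    · change b.repr (_ * b 0) i = _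
      rw [h0, hrepr]
      fin_cases i <;> simp
    · change b.repr (_ * b 1) i = _
      rw [h1, hrepr]
      fin_cases i <;> simp
  have htr : ∀ p q : k, Algebra.trace k K (p • (1 : K) + q • θ) = 2 * p + q * t := by
    intro p q
    rw [Algebra.trace_eq_matrix_trace b, hmat, Matrix.trace_fin_two_of]; ring
  have hnorm : ∀ p q : k,
      Algebra.norm k (p • (1 : K) + q • θ) = p ^ 2 + p * q * t + q ^ 2 * (-n') := by
    intro p q
    rw [Algebra.norm_eq_matrix_det b, hmat, Matrix.det_fin_two_of]; ring
  have hdb : Algebra.discr k b = t ^ 2 - 4 * (-n') := by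
    have t11 : Algebra.trace k K 1 = 2 := by simpa using htr 1 0
    have t1θ : Algebra.trace k K θ = t := by simpa using htr 0 1
    have tθθ : Algebra.trace k K (θ * θ) = 2 * n' + t * t := by rw [hsq, htr]
    rw [Algebra.discr_def, Matrix.det_fin_two]
    simp only [Algebra.traceMatrix_apply, Algebra.traceForm_apply, hb0, hb1, one_mul, mul_one,
      t11, t1θ, tθθ]
    ring
  obtain ⟨b', hb'⟩ := hδ
  -- The discriminants of two bases differ by the square of the transition determinant, which
  -- becomes c; separability gives δ ≠ 0.
  have hdiscr := Algebra.discr_of_matrix_vecMul (A := k) b (b.toMatrix b')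
  rw [b.toMatrix_map_vecMul b', hb', hdb] at hdiscr
  have hδ0 : δ ≠ 0 := by rw [← hb']; exact Algebra.discr_not_zero_of_basis k b'
  refine ⟨⟨θ, t, -n', (b.toMatrix b').det, ?_, ?_, hex, hind, htr, hnorm, hdiscr, ?_⟩⟩
  · intro h; rw [h] at hdiscr; exact hδ0 (by rw [hdiscr]; ring)
  · rw [hsq]; module
  · intro h; rw [h] at hdiscr; exact hδ0 (by rw [hdiscr]; ring)

namespace QuadraticGenerator

variable {k K : Type*} [Field k] [Field K] [Algebra k K] {δ : k}
  (g : QuadraticGenerator k (K := K) δ)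
include g

/-- Norm values `δ N(s)` with `T(s) ≠ 0` from values `-N(α - θ)`. -/
theorem exists_norm_eq (α : k) : ∃ s : K, s ≠ 0 ∧ Algebra.trace k K s ≠ 0 ∧
    δ * Algebra.norm k s = -(α ^ 2 - α * g.t + g.n) := by
  obtain ⟨D, hD'⟩ : ∃ D, D = g.t ^ 2 - 4 * g.n := ⟨_, rfl⟩
  have hD : D ≠ 0 := hD' ▸ g.discr_ne_zero
  have hc := g.c_ne_zero
  -- This element is s = (α - θ)/(cη) with η = 2θ - t and η² = t² - 4n = -N(η). Its trace is -1/c,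
  -- and δ N(s) = -N(α - θ).
  have htr : Algebra.trace k K (((2 * g.n - α * g.t) / (g.c * D)) • (1 : K) +
      ((2 * α - g.t) / (g.c * D)) • g.θ) = -(1 / g.c) := by
    rw [g.trace_eq, show 2 * ((2 * g.n - α * g.t) / (g.c * D)) + (2 * α - g.t) / (g.c * D) * g.t =
      -((g.t ^ 2 - 4 * g.n) / (g.c * D)) by ring, ← hD']
    field_simp
  have hne : -(1 / g.c) ≠ 0 := neg_ne_zero.mpr (one_div_ne_zero hc)
  refine ⟨((2 * g.n - α * g.t) / (g.c * D)) • (1 : K) + ((2 * α - g.t) / (g.c * D)) • g.θ,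
    ?_, by rw [htr]; exact hne, ?_⟩
  · intro h
    rw [h, map_zero] at htr
    exact hne htr.symm
  · rw [g.norm_eq]
    have hd := g.discr_eq
    rw [← hD'] at hd
    refine (congrArg (· * _) hd).trans ?_
    field_simp
    rw [hD']
    ring

theorem mul_eq (p q p' q' : k) : (p • (1 : K) + q • g.θ) * (p' • (1 : K) + q' • g.θ) =
    (p * p' - q * q' * g.n) • (1 : K) + (p * q' + q * p' + q * q' * g.t) • g.θ := by
  have : (p • (1 : K) + q • g.θ) * (p' • (1 : K) + q' • g.θ) =
      (p * p') • (1 : K) + (p * q' + q * p') • g.θ + (q * q') • (g.θ * g.θ) := by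
    simp only [add_mul, mul_add, smul_mul_assoc, mul_smul_comm, one_mul, mul_one]
    module
  rw [this, g.sq]
  module

end QuadraticGenerator

/-! ### Embedding k × K into a reduced algebra. -/

namespace Herm3

theorem ext_entries {k C : Type*} {x y : Herm3 k C} (h0 : x.1 0 = y.1 0) (h1 : x.1 1 = y.1 1)
    (h2 : x.1 2 = y.1 2) (k0 : x.2 0 = y.2 0) (k1 : x.2 1 = y.2 1) (k2 : x.2 2 = y.2 2) :
    x = y := by
  refine Prod.ext (funext fun i => ?_) (funext fun i => ?_)
  · fin_cases i <;> assumption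
  · fin_cases i <;> assumption

open OctonionAlgebra

variable {k C : Type*} [Field k] [NonAssocRing C] [Module k C] [OctonionAlgebra k C]

/-- The `U`-operator on elements `∑ α_i e_ii + a 1[23]`. -/
theorem jordan_U_apply_of_first (γ : Fin 3 → k) (α β : Fin 3 → k) (a b : k) :
    (jordan k C γ).U (α, ![a • 1, 0, 0]) (β, ![b • 1, 0, 0]) =
      (![α 0 * α 0 * β 0,
        α 1 * α 1 * β 1 + γ 1 * γ 2 * (2 * a * b * α 1 + a * a * β 2),
        α 2 * α 2 * β 2 + γ 1 * γ 2 * (2 * a * b * α 2 + a * a * β 1)],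
       ![(a * (α 1 * β 1 + α 2 * β 2) + b * (α 1 * α 2) + γ 1 * γ 2 * (a * a * b)) • 1, 0, 0]) := by
  have hc : conj k (0 : C) = 0 := by simp [conj, trace]
  have h1 : norm (k := k) (1 : C) = 1 := OctonionAlgebra.norm_one
  have h2 : QuadraticMap.polar (norm (k := k) (C := C)) 1 1 = 2 := polar_one_one
  have hadj : adj γ ((α, ![a • 1, 0, 0]) : Herm3 k C) =
      (![α 1 * α 2 - γ 1 * γ 2 * (a * a), α 2 * α 0, α 0 * α 1], ![(-(α 0 * a)) • (1 : C), 0, 0]) := by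
    rw [adj_apply]
    apply ext_entries <;>
    simp only [Matrix.cons_val, zero_add, Fin.reduceAdd, QuadraticMap.map_smul,
      QuadraticMap.map_zero, h1, smul_eq_mul, mul_one, mul_zero, zero_mul, sub_zero, hc, smul_zero,
      smul_smul, zero_sub, neg_smul]
  have hpol : ∀ (α' β' : Fin 3 → k) (a' b' : k),
      QuadraticMap.polar (adj γ) ((α', ![a' • 1, 0, 0]) : Herm3 k C) (β', ![b' • 1, 0, 0]) =
      (![α' 1 * β' 2 + β' 1 * α' 2 - γ 1 * γ 2 * (2 * a' * b'), α' 2 * β' 0 + β' 2 * α' 0,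
        α' 0 * β' 1 + β' 0 * α' 1], ![(-(α' 0 * b' + β' 0 * a')) • (1 : C), 0, 0]) := by
    intro α' β' a' b'
    rw [polar_adj]
    apply ext_entries <;>
    simp only [Matrix.cons_val, zero_add, Fin.reduceAdd, QuadraticMap.polar_smul_left,
      QuadraticMap.polar_smul_right, QuadraticMap.polar_zero_left, h2, smul_eq_mul, mul_zero,
      zero_mul, add_zero, sub_zero, hc, smul_zero]
    · ring
    · module
  rw [jordan_U, hadj, hpol, traceForm_apply, Fin.sum_univ_three]
  apply ext_entries <;>
  simp only [Matrix.cons_val, zero_add, Fin.reduceAdd, QuadraticMap.polar_smul_left,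
    QuadraticMap.polar_smul_right, QuadraticMap.polar_zero_left, h2, smul_eq_mul, mul_zero,
    add_zero, sub_zero, smul_zero, Prod.fst_sub, Prod.snd_sub, Prod.smul_fst,
    Prod.smul_snd, Pi.sub_apply, Pi.smul_apply]
  · ring
  · ring
  · ring
  · module

end Herm3

/-- The generator θ goes to the block with diagonal a, b and off-diagonal part κ 1[23]. Its trace is
a + b = t and its determinant ab - νκ² = n, so it satisfies the equation of θ. -/
theorem exists_hom_of_herm3 {k K A C : Type*} [Field k] [Field K] [Algebra k K] [AddCommGroup A]
    [Module k A] [NonAssocRing C] [Module k C] [OctonionAlgebra k C] {δ : k}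
    (g : QuadraticGenerator k (K := K) δ) (J : JordanStr k A) {r : k} {s : K}
    (hs : Algebra.trace k K s ≠ 0) (f : A ≃ₗ[k] Herm3 k C)
    (hf : J.IsHom (Herm3.jordan k C ![r, 1, δ * Algebra.norm k s]) f.toLinearMap) :
    ∃ φ : (k × K) →ₗ[k] A, Function.Injective φ ∧ (JordanStr.ofComm k (k × K)).IsHom J φ := by
  obtain ⟨p, q, hpq⟩ := g.exists_eq s
  obtain ⟨e, he⟩ : ∃ e, e = 2 * p + q * g.t := ⟨_, rfl⟩
  have hc := g.c_ne_zero
  rw [hpq, g.trace_eq, ← he] at hs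
  obtain ⟨ν, hν⟩ : ∃ ν, ν = δ * Algebra.norm k s := ⟨_, rfl⟩
  have hν' : ν = g.c ^ 2 * (g.t ^ 2 - 4 * g.n) * (p ^ 2 + p * q * g.t + q ^ 2 * g.n) := by
    rw [hν, hpq, g.norm_eq, ← g.discr_eq]
  rw [← hν] at hf
  -- With e = T(s) ≠ 0, these are a = T(sθ)/T(s), b = T(s conj(θ))/T(s) and κ = 1/(c T(s)).
  obtain ⟨a, b', κ, hκ, ht, hn⟩ : ∃ a b κ : k, κ ≠ 0 ∧ g.t = a + b ∧ g.n = a * b - ν * κ ^ 2 := by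
    refine ⟨(p * g.t + q * g.t ^ 2 - 2 * q * g.n) / e, (p * g.t + 2 * q * g.n) / e, 1 / (e * g.c),
      one_div_ne_zero (mul_ne_zero hs hc), ?_, ?_⟩
    · field_simp
      rw [he]
      ring
    · rw [hν']
      field_simp
      rw [he]
      ring
  let b : Module.Basis (Fin 2) k K := Module.Basis.mk (v := ![(1 : K), g.θ])
    (LinearIndependent.pair_iff.mpr g.indep) (by
      intro x _
      obtain ⟨p, q, rfl⟩ := g.exists_eq x
      exact Submodule.add_mem _
        (Submodule.smul_mem _ _ (Submodule.subset_span ⟨0, rfl⟩))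
        (Submodule.smul_mem _ _ (Submodule.subset_span ⟨1, rfl⟩)))
  have hb : ∀ p q : k, b.equivFun (p • (1 : K) + q • g.θ) = ![p, q] := by
    intro p q
    rw [← LinearEquiv.eq_symm_apply, Module.Basis.equivFun_symm_apply, Fin.sum_univ_two]
    simp [b]
  let ψ₀ : (k × (Fin 2 → k)) →ₗ[k] Herm3 k C :=
    { toFun := fun z => (![z.1, z.2 0 + z.2 1 * a,
          z.2 0 + z.2 1 * b'], ![(z.2 1 * κ) • 1, 0, 0])
      map_add' := fun z w => by
        apply Herm3.ext_entries <;>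
        simp only [Matrix.cons_val, Prod.fst_add, Prod.snd_add, Pi.add_apply, add_zero]
        · ring
        · ring
        · module
      map_smul' := fun c z => by
        apply Herm3.ext_entries <;>
        simp only [Matrix.cons_val, Prod.smul_fst, Prod.smul_snd, Pi.smul_apply, smul_eq_mul,
          RingHom.id_apply, smul_zero]
        · ring
        · ring
        · module }
  let ψ : (k × K) →ₗ[k] Herm3 k C :=
    ψ₀.comp (LinearMap.prodMap LinearMap.id b.equivFun.toLinearMap)
  have hψ : ∀ z p' q', ψ (z, p' • (1 : K) + q' • g.θ) =
      (![z, p' + q' * a,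
          p' + q' * b'], ![(q' * κ) • 1, 0, 0]) := by
    intro z p' q'
    change ψ₀ (z, b.equivFun (p' • (1 : K) + q' • g.θ)) = _
    rw [hb]
    rfl
  have hψ1 : ψ 1 = (Herm3.jordan k C ![r, 1, ν]).one := by
    have h1 : (1 : k × K) = (1, (1 : k) • (1 : K) + (0 : k) • g.θ) := by
      rw [one_smul, zero_smul, add_zero]; rfl
    rw [h1, hψ]
    change _ = ((fun _ => 1, fun _ => 0) : Herm3 k C)
    apply Herm3.ext_entries <;> simp
  have hψU : ∀ x y : k × K, ψ (x * y * x) = (Herm3.jordan k C ![r, 1, ν]).U (ψ x) (ψ y) := by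
    rintro ⟨z, x⟩ ⟨w, y⟩
    obtain ⟨x0, x1, rfl⟩ := g.exists_eq x
    obtain ⟨y0, y1, rfl⟩ := g.exists_eq y
    rw [Prod.mk_mul_mk, Prod.mk_mul_mk, g.mul_eq, g.mul_eq, hψ, hψ, hψ,
      Herm3.jordan_U_apply_of_first]
    apply Herm3.ext_entries <;> simp only [Matrix.cons_val, one_mul, ht, hn]
    · ring
    · ring
    · ring
    · congr 1; ring
  refine ⟨f.symm.toLinearMap.comp ψ, ?_, ?_, fun x y => ?_⟩
  · refine f.symm.injective.comp ?_
    rw [injective_iff_map_eq_zero]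
    rintro ⟨z, x⟩ hx
    obtain ⟨x0, x1, rfl⟩ := g.exists_eq x
    rw [hψ] at hx
    have hz : z = 0 := congrFun (congrArg Prod.fst hx) 0
    have h1 : (x1 * κ) • (1 : C) = 0 := congrFun (congrArg Prod.snd hx) 0
    have hx1 : x1 = 0 := by
      have h2 := congrArg (OctonionAlgebra.norm (k := k)) h1
      rw [QuadraticMap.map_smul, OctonionAlgebra.norm_one, QuadraticMap.map_zero, smul_eq_mul,
        mul_one, mul_self_eq_zero] at h2
      exact (mul_eq_zero.mp h2).resolve_right hκ
    have hx0 : x0 + x1 * a = 0 := congrFun (congrArg Prod.fst hx) 1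
    rw [hx1, zero_mul, add_zero] at hx0
    rw [hz, hx0, hx1, zero_smul, zero_smul, add_zero]
    rfl
  · change f.symm (ψ 1) = J.one
    rw [hψ1, LinearEquiv.symm_apply_eq]
    exact hf.1.symm
  · rw [JordanStr.ofComm_U]
    change f.symm (ψ _) = J.U (f.symm (ψ x)) (f.symm (ψ y))
    rw [hψU, LinearEquiv.symm_apply_eq]
    have := hf.2 (f.symm (ψ x)) (f.symm (ψ y))
    simpa using this.symm

/-! ### The image of k × K in an Albert algebra. -/

namespace IsBaseChange

variable {k F A B : Type*} [Field k] [Field F] [Algebra k F] [AddCommGroup A] [Module k A]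
  [AddCommGroup B] [Module k B] [Module F B] [IsScalarTower k F B] {j : A →ₗ[k] B}
  (hj : IsBaseChange F j)
include hj

theorem eq_zero_of_smul_add_smul_eq_zero {x y : A} (hy : y ≠ 0) (hx : x ∉ Submodule.span k {y})
    {a b : F} (h : a • j x + b • j y = 0) : a = 0 ∧ b = 0 := by
  obtain ⟨f, hfx, hfy⟩ := Submodule.exists_le_ker_of_notMem hx
  have hfy : f y = 0 := hfy (Submodule.mem_span_singleton_self y)
  obtain ⟨g, hg⟩ := exists_dual_apply hj f
  have ha : a = 0 := by
    have h1 := congrArg g h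
    rw [map_add, map_smul, map_smul, hg, hg, hfy, map_zero, smul_zero, add_zero, smul_eq_mul,
      map_zero] at h1
    exact (mul_eq_zero.mp h1).resolve_right (by simpa using hfx)
  refine ⟨ha, ?_⟩
  rw [ha, zero_smul, zero_add] at h
  exact (smul_eq_zero.mp h).resolve_right fun h0 =>
    hy (injective_of_field hj (h0.trans (map_zero j).symm))

theorem finrank_eq_of_field : Module.finrank k A = Module.finrank F B := by
  rw [← hj.equiv.finrank_eq, Module.finrank_baseChange]

end IsBaseChange

section

variable {k K A : Type*} [Field k] [Field K] [Algebra k K] [AddCommGroup A] [Module k A]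
  {δ : k} (g : QuadraticGenerator k (K := K) δ) {J : JordanStr k A} {φ : (k × K) →ₗ[k] A}
  (hφ : Function.Injective φ) (hφJ : (JordanStr.ofComm k (k × K)).IsHom J φ)

section
include hφJ

theorem map_one_of_isHom : φ 1 = J.one := hφJ.1

theorem map_mul_of_isHom (x y : k × K) : J.U (φ x) (φ y) = φ (x * y * x) := by
  rw [← hφJ.2, JordanStr.ofComm_U]

end

include hφ

theorem map_notMem_span {x y : k × K} (h : ∀ c : k, c • y ≠ x) :
    φ x ∉ Submodule.span k {φ y} := by
  intro hm
  obtain ⟨c, hc⟩ := Submodule.mem_span_singleton.mp hm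
  exact h c (hφ (by rw [map_smul, hc]))

include g hφJ

/-- The image of `(1, 0)` is an idempotent of rank one. -/
theorem isPrimitive_map_one_zero {F B : Type*} [Field F] [Algebra k F] [AddCommGroup B] [Module k B]
    [Module F B] [IsScalarTower k F B] {j : A →ₗ[k] B} (hj : IsBaseChange F j)
    (S : CubicJordan F B) (N : B → F)
    (hN : ∀ x y, S.cross (S.adj x) (S.cross x y) = N x • y + S.T (S.adj x) y • x)
    (ho : j J.one = S.one) (hV : ∀ x y, j (J.U x y) = S.U (j x) (j y)) :
    S.IsPrimitive (j (φ (1, 0))) := by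
  have hφ0 : ∀ {x : k × K}, x ≠ 0 → φ x ≠ 0 := fun hx h => hx (hφ (h.trans (map_zero φ).symm))
  have hone := map_one_of_isHom hφJ
  have hidem : ∀ x : k × K, x * x = x → S.U (j (φ x)) S.one = j (φ x) ∧
      S.U (j (φ x)) (j (φ x)) = j (φ x) := by
    intro x hx
    rw [← ho, ← hV, ← hV, ← hone, map_mul_of_isHom hφJ, map_mul_of_isHom hφJ, mul_one, hx, hx]
    exact ⟨rfl, rfl⟩
  have h10 := hidem (1, 0) (by simp)
  rcases S.isPrimitive_or_of_idempotent N hN (j (φ (1, 0))) (fun a b hab => by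
    rw [← ho, ← hone] at hab
    refine IsBaseChange.eq_zero_of_smul_add_smul_eq_zero hj (hφ0 one_ne_zero)
      (map_notMem_span hφ fun c hc => ?_) hab
    have h1 := congrArg Prod.fst hc
    have h2 := congrArg Prod.snd hc
    simp only [Prod.smul_fst, Prod.smul_snd, Prod.fst_one, Prod.snd_one, smul_eq_mul,
      mul_one] at h1 h2
    rw [h1, one_smul] at h2
    exact one_ne_zero h2) h10.1 h10.2 with h | h
  · exact h
  · exfalso
    have h01 : S.one - j (φ (1, 0)) = j (φ (0, 1)) := by
      rw [← ho, ← hone, ← map_sub, ← map_sub]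
      congr 2
      refine Prod.ext ?_ ?_ <;> simp
    rw [h01] at h
    -- If 1 - e had rank one, U_{1-e} would map onto its line; but it fixes the image of (0, θ),
    -- which is independent of (0, 1).
    have hw : S.T (j (φ (0, 1))) (j (φ (0, g.θ))) • j (φ (0, 1)) = j (φ (0, g.θ)) := by
      rw [← h.U_eq, ← hV, map_mul_of_isHom hφJ]
      simp
    obtain ⟨c, hc⟩ := IsBaseChange.mem_range_of_smul_eq hj
      (hφ0 (x := (0, 1)) (fun h0 => one_ne_zero (congrArg Prod.snd h0))) hw
    rw [← hc, algebraMap_smul, ← map_smul, ← map_smul] at hw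
    have h2 := congrArg Prod.snd (hφ (IsBaseChange.injective_of_field hj hw))
    simp only [Prod.smul_mk] at h2
    have h3 := (g.indep c (-1) (by rw [h2]; module)).2
    exact one_ne_zero (neg_eq_zero.mp h3)

/-- The image of `(0, θ)` lies in the Peirce space `A_0` of the image of `(1, 0)`, and has the same
trace and norm as `θ`. -/
theorem peirceZero_map_generator (R : CubicJordan k A) (ho : R.one = J.one)
    (hV : ∀ x y, J.U x y = R.U x y) (he : R.IsPrimitive (φ (1, 0))) :
    R.PeirceZero (φ (1, 0)) (φ (0, g.θ)) ∧ R.tr (φ (0, g.θ)) = g.t ∧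
      R.tr (R.adj (φ (0, g.θ))) = g.n := by
  have hone := map_one_of_isHom hφJ
  have h01 : R.one - φ (1, 0) = φ (0, 1) := by
    rw [ho, ← hone, ← map_sub]
    congr 1
    refine Prod.ext ?_ ?_ <;> simp
  have hp : R.PeirceZero (φ (1, 0)) (φ (0, g.θ)) := by
    -- U of (0, 1) fixes (0, θ) and is the projection onto A_0(e).
    have h1 : R.peirceZero (φ (1, 0)) (φ (0, g.θ)) = φ (0, g.θ) := by
      rw [← he.U_one_sub, h01, ← hV, map_mul_of_isHom hφJ]
      simp
    rw [← h1]
    exact he.peirceZero_mem _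
  -- Comparing the quadratic equation of A_0(e) with θ² = tθ - n identifies the coefficients, as 1
  -- and θ are independent.
  have hsq := he.U_self_one_of_peirceZero hp
  rw [h01, ← hV, ho, ← hone, map_mul_of_isHom hφJ, ← map_smul, ← map_smul, ← map_sub] at hsq
  have h2 := congrArg Prod.snd (hφ hsq)
  simp only [mul_one, Prod.mk_mul_mk, g.sq, Prod.smul_mk, Prod.mk_sub_mk] at h2
  have h3 := g.indep (R.tr (R.adj (φ (0, g.θ))) - g.n) (g.t - R.tr (φ (0, g.θ)))
    (by linear_combination (norm := module) h2)
  exact ⟨hp, by linear_combination -h3.2, by linear_combination h3.1⟩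

end

/-! ### Assembly of the two directions. -/

theorem Herm3.finrank_split (F : Type*) [Field F] : Module.finrank F (Herm3 F (Zorn F)) = 27 := by
  have : Module.Finite F (Zorn F) :=
    Module.finite_of_finrank_pos (by rw [Zorn.finrank_eq]; norm_num)
  rw [Module.finrank_prod, Module.finrank_pi, Module.finrank_pi_fintype]
  simp [Zorn.finrank_eq]

theorem JordanStr.IsHom.symm {k A B : Type*} [Field k] [AddCommGroup A] [Module k A]
    [AddCommGroup B] [Module k B] {J : JordanStr k A} {J' : JordanStr k B} {f : A ≃ₗ[k] B}
    (hf : J.IsHom J' f.toLinearMap) : J'.IsHom J f.symm.toLinearMap := by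
  obtain ⟨h1, hU⟩ := hf
  refine ⟨?_, fun x y => ?_⟩
  · exact (LinearEquiv.symm_apply_eq f).mpr h1.symm
  · refine (LinearEquiv.symm_apply_eq f).mpr ?_
    have h := hU (f.symm x) (f.symm y)
    simp only [LinearEquiv.coe_coe, LinearEquiv.apply_symm_apply] at h
    exact h.symm

theorem CubicJordan.Frame.Coord.isHom_hermMap {k A V : Type*} [Field k] [AddCommGroup A]
    [Module k A] {S : CubicJordan k A} {Φ : S.Frame} [AddCommGroup V] [Module k V]
    (D : Φ.Coord V) {J : JordanStr k A} (h1 : S.one = J.one) (hU : ∀ x y, J.U x y = S.U x y) :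
    (Herm3.jordan k D.Alg D.Γ).IsHom J D.hermMap :=
  ⟨D.hermMap_one.trans h1, fun x y => (D.hermMap_U x y).trans (hU _ _).symm⟩

theorem exists_herm3_of_cubicJordan {k : Type u} {K : Type v} {A : Type w} [Field k] [Field K]
    [Algebra k K] [AddCommGroup A] [Module k A] {δ : k} (g : QuadraticGenerator k (K := K) δ)
    {J : JordanStr k A} {φ : (k × K) →ₗ[k] A} (hφ : Function.Injective φ)
    (hφJ : (JordanStr.ofComm k (k × K)).IsHom J φ) (R : CubicJordan k A) (hR1 : R.one = J.one)
    (hRU : ∀ x y, J.U x y = R.U x y) (heR : R.IsPrimitive (φ (1, 0)))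
    (hdim : Module.finrank k A = 27) (hne : ∃ y, R.peirceOne (φ (1, 0)) y ≠ 0)
    (hadj : ∀ x, ∃ c : k, R.adj (R.adj x) = c • x) :
    ∃ (C : Type u) (_ : NonAssocRing C) (_ : Module k C) (_ : OctonionAlgebra k C) (r : k) (s : K),
      r ≠ 0 ∧ s ≠ 0 ∧ Algebra.trace k K s ≠ 0 ∧
      ∃ f : A ≃ₗ[k] Herm3 k C,
        J.IsHom (Herm3.jordan k C ![r, 1, δ * Algebra.norm k s]) f.toLinearMap := by
  obtain ⟨y, hy⟩ := hne
  obtain ⟨x, hx, hx'⟩ := heR.exists_tr_adj_ne_zero hy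
  obtain ⟨Φ, hΦ⟩ := heR.exists_frame hx hx' (hadj x)
  obtain ⟨hw, hwt, hwn⟩ := peirceZero_map_generator g hφ hφJ R hR1 hRU heR
  rw [← hΦ] at hx hw
  have hq := CubicJordan.Frame.q_comp_zero_of_peirceZero hw
  -- Here α is the e_1-entry of the image of θ, so the off-diagonal component has q equal to -N(α -
  -- θ).
  obtain ⟨s, hs, hs', hsN⟩ := g.exists_norm_eq (R.T (Φ.e 1) (φ (0, g.θ)))
  have hqs : R.q (Φ.comp 0 (φ (0, g.θ))) = δ * Algebra.norm k s := by
    rw [hq, hwt, hwn, hsN]; ring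
  have hδ : δ ≠ 0 := fun h =>
    mul_ne_zero (pow_ne_zero 2 g.c_ne_zero) g.discr_ne_zero (g.discr_eq.symm.trans h)
  have hq0 : R.q (Φ.comp 0 (φ (0, g.θ))) ≠ 0 := by
    have : Module.Finite k K := by
      refine Module.Finite.of_surjective
        (LinearMap.coprod (LinearMap.toSpanSingleton k K 1) (LinearMap.toSpanSingleton k K g.θ))
        fun z => ?_
      obtain ⟨p, q, rfl⟩ := g.exists_eq z
      exact ⟨(p, q), by simp⟩
    rw [hqs]
    exact mul_ne_zero hδ (Algebra.norm_ne_zero_iff.mpr hs)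
  obtain ⟨u₂, hu₂, hqu₂⟩ := CubicJordan.Frame.exists_mem_two_of_peirceOne hx hx'
    (Φ.comp_mem 0 _) hq0
  obtain ⟨m, D, hD0, hD2⟩ := Φ.exists_coord hdim (Φ.comp_mem 0 _) hu₂ hq0 hqu₂
  have hΓ : D.Γ = ![R.q u₂, 1, δ * Algebra.norm k s] := by
    rw [CubicJordan.Frame.Coord.Γ, hD0, hD2, hqs]
  have hf := (show (Herm3.jordan k D.Alg D.Γ).IsHom J
      (LinearEquiv.ofBijective D.hermMap D.hermMap_bijective).toLinearMap from
    D.isHom_hermMap hR1 hRU).symm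
  rw [hΓ] at hf
  exact ⟨D.Alg, inferInstance, inferInstance, inferInstance, R.q u₂, s, hqu₂, hs, hs', _, hf⟩

/-- A Jordan structure which over an extension field becomes that of a cubic Jordan structure
satisfying the adjoint identity is itself cubic, if it contains `k × K`. -/
theorem exists_cubicJordan_of_isBaseChange {k K A F B : Type*} [Field k] [Field K] [Algebra k K]
    [AddCommGroup A] [Module k A] {δ : k} (g : QuadraticGenerator k (K := K) δ)
    {J : JordanStr k A} {φ : (k × K) →ₗ[k] A} (hφ : Function.Injective φ)
    (hφJ : (JordanStr.ofComm k (k × K)).IsHom J φ)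
    [Field F] [Infinite F] [Algebra k F] [AddCommGroup B] [Module k B]
    [Module F B] [IsScalarTower k F B] {j : A →ₗ[k] B} (hj : IsBaseChange F j)
    (S : CubicJordan F B) (N : B → F)
    (hN : ∀ x y, S.cross (S.adj x) (S.cross x y) = N x • y + S.T (S.adj x) y • x)
    (hNadj : ∀ x, S.adj (S.adj x) = N x • x)
    (hne : ∀ e, S.IsPrimitive e → ∃ y, S.peirceOne e y ≠ 0)
    (ho : j J.one = S.one) (hV : ∀ x y, j (J.U x y) = S.U (j x) (j y)) :
    ∃ R : CubicJordan k A, R.one = J.one ∧ (∀ x y, J.U x y = R.U x y) ∧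
      R.IsPrimitive (φ (1, 0)) ∧ (∃ y, R.peirceOne (φ (1, 0)) y ≠ 0) ∧
      ∀ x, ∃ c : k, R.adj (R.adj x) = c • x := by
  have he := isPrimitive_map_one_zero g hφ hφJ hj S N hN ho hV
  obtain ⟨R, hR1, hRadj, hRT⟩ :=
    CubicJordan.exists_descent hj S (V := fun x y => J.U x y) ho hV he
  have hinj := IsBaseChange.injective_of_field hj
  have halg : Function.Injective (algebraMap k F) := (algebraMap k F).injective
  have hRcross : ∀ x y, j (R.cross x y) = S.cross (j x) (j y) := fun x y => by
    have h := R.adj_add x y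
    have h2 := S.adj_add (j x) (j y)
    rw [← map_add, ← hRadj, h, map_add, map_add, hRadj, hRadj] at h2
    exact add_left_cancel h2
  have hRU : ∀ x y, J.U x y = R.U x y := fun x y => hinj (by
    rw [hV, CubicJordan.U, CubicJordan.U, map_sub, map_smul, hRcross, hRadj, ← hRT, algebraMap_smul])
  have hRtr : ∀ x, algebraMap k F (R.tr x) = S.tr (j x) := fun x => by
    rw [← R.one_T, ← S.one_T, hRT, hR1, ho]
  refine ⟨R, hR1, hRU, ⟨hinj (by rw [hRadj, he.adj_eq, map_zero]),
    halg (by rw [hRtr, he.tr_eq, map_one])⟩, ?_, fun x => ?_⟩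
  · by_contra! h
    obtain ⟨y, hy⟩ := hne _ he
    -- The Peirce projection is F-linear, so if it vanished on the k-form it would vanish over F.
    let p : B →ₗ[F] B :=
      { toFun := S.peirceOne (j (φ (1, 0)))
        map_add' := S.peirceOne_add _
        map_smul' := S.peirceOne_smul _ }
    refine hy (IsBaseChange.eq_zero_of_forall_apply hj p (fun a => ?_) y)
    change S.peirceOne (j (φ (1, 0))) (j a) = 0
    rw [← map_zero j, ← h a]
    rw [CubicJordan.peirceOne, CubicJordan.peirceOne, ← hRtr, ← hRT, ← ho, ← hR1, ← hRcross,
      ← map_sub, algebraMap_smul, algebraMap_smul, ← map_ofNat (algebraMap k F) 2, ← map_mul,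
      algebraMap_smul]
    simp only [map_sub, map_add, map_smul]
  · by_cases hx0 : x = 0
    · exact ⟨0, by rw [hx0, QuadraticMap.map_zero, QuadraticMap.map_zero, smul_zero]⟩
    -- The cubic norm is not part of the descended data, but N(x) x = x^♯♯ is rational, so N(x) lies
    -- in k.
    · obtain ⟨c, hc⟩ := IsBaseChange.mem_range_of_smul_eq hj hx0
        (c := N (j x)) (b := R.adj (R.adj x)) (by rw [hRadj, hRadj]; exact (hNadj (j x)).symm)
      exact ⟨c, hinj (by
        rw [hRadj, hRadj, map_smul, ← algebraMap_smul F c, hc]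
        exact hNadj (j x))⟩

namespace Herm3

variable {k : Type*} [Field k]

theorem cubicJordan_adj_adj [Infinite k] (x : Herm3 k (Zorn k)) :
    (cubicJordan k).adj ((cubicJordan k).adj x) = cubicNorm x • x :=
  adj_adj x

theorem cubicJordan_cross_adj [Infinite k] (x y : Herm3 k (Zorn k)) :
    (cubicJordan k).cross ((cubicJordan k).adj x) ((cubicJordan k).cross x y) =
      cubicNorm x • y + (cubicJordan k).T ((cubicJordan k).adj x) y • x :=
  (adj_identities x y).1

theorem jordan_U_eq [Infinite k] (x y : Herm3 k (Zorn k)) :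
    (jordan k (Zorn k) fun _ => 1).U x y = (cubicJordan k).U x y :=
  rfl

end Herm3

theorem exists_herm3_of_hom {k : Type u} {K : Type v} {A : Type w} [Field k] [Field K] [Algebra k K]
    [AddCommGroup A] [Module k A] {δ : k} (g : QuadraticGenerator k (K := K) δ)
    {J : JordanStr k A} (hJ : IsAlbert J) {φ : (k × K) →ₗ[k] A} (hφ : Function.Injective φ)
    (hφJ : (JordanStr.ofComm k (k × K)).IsHom J φ) :
    ∃ (C : Type u) (_ : NonAssocRing C) (_ : Module k C) (_ : OctonionAlgebra k C) (r : k) (s : K),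
      r ≠ 0 ∧ s ≠ 0 ∧ Algebra.trace k K s ≠ 0 ∧
      ∃ f : A ≃ₗ[k] Herm3 k C,
        J.IsHom (Herm3.jordan k C ![r, 1, δ * Algebra.norm k s]) f.toLinearMap := by
  obtain ⟨j, hj, hj1, hjU⟩ := hJ
  have : Infinite (SeparableClosure k) := IsSepClosed.infinite _
  obtain ⟨R, hR1, hRU, heR, hne, hadj⟩ := exists_cubicJordan_of_isBaseChange g hφ hφJ hj
    (Herm3.cubicJordan (SeparableClosure k)) Herm3.cubicNorm
    Herm3.cubicJordan_cross_adj Herm3.cubicJordan_adj_adj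
    (fun _ => Herm3.exists_peirceOne_ne_zero) hj1
    (fun x y => (hjU x y).trans (Herm3.jordan_U_eq _ _))
  refine exists_herm3_of_cubicJordan g hφ hφJ R hR1 hRU heR ?_ hne hadj
  rw [IsBaseChange.finrank_eq_of_field hj, Herm3.finrank_split]

theorem mainTheorem3 {k : Type u} [Field k] {K : Type v} [Field K] [Algebra k K]
    [Algebra.IsSeparable k K] (hK : Module.finrank k K = 2)
    (δ : k) (hδ : ∃ b : Module.Basis (Fin 2) k K, Algebra.discr k b = δ)
    {A : Type w} [AddCommGroup A] [Module k A] (J : JordanStr k A) (hJ : IsAlbert J) :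
    (∃ φ : (k × K) →ₗ[k] A, Function.Injective φ ∧ (JordanStr.ofComm k (k × K)).IsHom J φ) ↔
    (∃ (C : Type u) (_ : NonAssocRing C) (_ : Module k C) (_ : OctonionAlgebra k C) (r : k) (s : K),
      r ≠ 0 ∧ s ≠ 0 ∧ Algebra.trace k K s ≠ 0 ∧
      ∃ f : A ≃ₗ[k] Herm3 k C,
        J.IsHom (Herm3.jordan k C ![r, 1, δ * Algebra.norm k s]) f.toLinearMap) := by
  obtain ⟨g⟩ := exists_quadraticGenerator hK δ hδ
  constructor
  · rintro ⟨φ, hφ, hφJ⟩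
    exact exists_herm3_of_hom g hJ hφ hφJ
  · rintro ⟨C, _, _, _, r, s, -, -, hs, f, hf⟩
    exact exists_hom_of_herm3 g J hs f hf
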